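/- Let $X$ be a countable (finite or countably infinite) set and let $I(X)$ be the symmetric inverse semigroup on $X$: the partial injective maps $X\to X$, written on the right and composed from left to right, with zero the empty map $0$ and identity $1=\mathrm{id}_X$. For $\alpha\in I(X)$ with $\alpha\neq 0$ let $\mathbb P(\alpha)$ be the set of all $\gamma\in I(X)$ such that $\mu\alpha\gamma\neq 0$ for every $\mu\in I(X)$ with $\mu\alpha\neq 0$; let $\mathbb P(0)=\{0\}$ and $\mathbb P^1(\alpha)=\mathbb P(\alpha)\cup\{1\}$. Elements $\alpha,\beta$ are $c$-conjugate, $\alpha\sim_c\beta$, if there are $\gamma\in\mathbb P^1(\alpha)$ and $\eta\in\mathbb P^1(\beta)$ with $\alpha\gamma=\gamma\beta$ and $\beta\eta=\eta\alpha$. The following elements of $I(X)$, where the listed points $x_i$ are pairwise distinct and the map is defined only where indicated, are called basic: a cycle of length $k\ge1$ ($x_0\mapsto x_1\mapsto\cdots\mapsto x_{k-1}\mapsto x_0$); a chain of length $k\geq 1$ ($x_0\mapsto x_1\mapsto\cdots\mapsto x_k$); a double ray ($x_i\mapsto x_{i+1}$ for all $i\in\mathbb Z$); a right ray ($x_i\mapsto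 x_{i+1}$ for all $i\ge 0$); a left ray ($x_{i+1}\mapsto x_{i}$ for all $i\ge 0$). Every $\alpha\in I(X)$ is, for a unique set of basic elements whose spans (domain union image) are pairwise disjoint, the join (union) of these elements. Let $\Delta_\alpha^k$, $\Theta_\alpha^k$, $\Omega_\alpha$, $\Upsilon_\alpha$, $\Lambda_\alpha$ denote the sets of, respectively, cycles of length $k$, chains of length $k$, double rays, right rays and left rays in this decomposition of $\alpha$. Let $k_\alpha=\sup\{k\ge 1:\Theta_\alpha^k\ne\emptyset\}\in\mathbb N\cup\{\aleph_0\}$, with $k_\alpha=0$ if $\alpha$ has no chains. If $k_\alpha$ is a positive integer, let $m_\alpha=\max\{m\in\{1,\dots,k_\alpha\}:|\Theta_\alpha^m|=\aleph_0\}$, with $m_\alpha=0$ if there is no such $m$. Then for all $\alpha,\beta\in I(X)$, $\alpha\sim_c\beta$ if and only if the following conditions hold: 1. $|\Delta_\alpha^k|=|\Delta_\beta^k|$ for every integer $k\ge 1$, $|\Omega_\alpha|=|\Omega_\beta|$ and $|\Lambda_\alpha|=|\Lambda_\beta|$; 2. if $\Omega_\alpha$ is finite, then $|\Upsilon_\alpha|=|\Upsilon_\beta|$;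 3. if $\Lambda_\alpha$ is finite, then (i) $k_\alpha=k_\beta$; and (ii) if $k_\alpha$ is a positive integer, then $m_\alpha=m_\beta$ and $|\Theta_\alpha^k|=|\Theta_\beta^k|$ for every $k\in\{m_\alpha+1,\dots,k_\alpha\}$. -/

import Mathlib

open Cardinal

/-- The symmetric inverse semigroup `I(X)`: partial injective transformations of `X`
(`y ∈ α x` says that `x ∈ dom α` and `xα = y`). -/
abbrev SymInv (X : Type*) := X ≃. X

namespace SymInv

/-- `I(X)` is a monoid with zero. Functions are composed from left to right,
`x(αβ) = (xα)β`, and the zero is the empty map. -/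
instance instMonoidWithZero {X : Type*} : MonoidWithZero (SymInv X) where
  mul α β := PEquiv.trans α β
  one := PEquiv.refl X
  zero := ⊥
  mul_assoc α β γ := PEquiv.trans_assoc α β γ
  one_mul α := PEquiv.refl_trans α
  mul_one α := PEquiv.trans_refl α
  zero_mul α := PEquiv.bot_trans α
  mul_zero α := PEquiv.trans_bot α

end SymInv

/-- The set `ℙ(a)` in a semigroup `S` with zero and identity (so that `S¹ = S`):
`ℙ(0) = {0}`, and for `a ≠ 0` it consists of all `g` with `(ma)g ≠ 0` for every
`ma ∈ S¹a \ {0}`. -/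
def conjugatorSet {S : Type*} [MonoidWithZero S] (a : S) : Set S :=
  {g | (a = 0 → g = 0) ∧ (a ≠ 0 → ∀ m : S, m * a ≠ 0 → m * a * g ≠ 0)}

/-- The set `ℙ¹(a) = ℙ(a) ∪ {1}`. -/
def conjugatorSetOne {S : Type*} [MonoidWithZero S] (a : S) : Set S :=
  conjugatorSet a ∪ {1}

/-- `c`-conjugacy `a ∼c b`. -/
def CConj {S : Type*} [MonoidWithZero S] (a b : S) : Prop :=
  ∃ g ∈ conjugatorSetOne a, ∃ h ∈ conjugatorSetOne b, a * g = g * b ∧ b * h = h * a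

namespace SymInv

variable {X : Type*}

/-- The domain of `α`. -/
def dom (α : SymInv X) : Set X := {x | ∃ y, y ∈ α x}

/-- The image of `α`. -/
def im (α : SymInv X) : Set X := {y | ∃ x, y ∈ α x}

/-- The span of `α`. -/
def span (α : SymInv X) : Set X := α.dom ∪ α.im

/-- `α` and `β` are completely disjoint. -/
def CompletelyDisjoint (α β : SymInv X) : Prop := α.span ∩ β.span = ∅

/-- `δ` is a cycle `(x₀ x₁ … x_{k-1})` of length `k ≥ 1`. -/
def IsCycle (k : ℕ) (δ : SymInv X) : Prop :=
  1 ≤ k ∧ ∃ x : ℕ → X, Set.InjOn x (Set.Iio k) ∧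
    ∀ a b : X, b ∈ δ a ↔ ∃ i < k, x i = a ∧ x ((i + 1) % k) = b

/-- `θ` is a chain `[x₀ x₁ … x_k]` of length `k ≥ 1`. -/
def IsChain (k : ℕ) (θ : SymInv X) : Prop :=
  1 ≤ k ∧ ∃ x : ℕ → X, Set.InjOn x (Set.Iic k) ∧
    ∀ a b : X, b ∈ θ a ↔ ∃ i < k, x i = a ∧ x (i + 1) = b

/-- `ω` is a double ray `⟨… x₋₁ x₀ x₁ …⟩`. -/
def IsDoubleRay (ω : SymInv X) : Prop :=
  ∃ x : ℤ → X, Function.Injective x ∧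
    ∀ a b : X, b ∈ ω a ↔ ∃ i, x i = a ∧ x (i + 1) = b

/-- `υ` is a right ray `[x₀ x₁ x₂ …⟩`. -/
def IsRightRay (υ : SymInv X) : Prop :=
  ∃ x : ℕ → X, Function.Injective x ∧
    ∀ a b : X, b ∈ υ a ↔ ∃ i, x i = a ∧ x (i + 1) = b

/-- `l` is a left ray `⟨… x₂ x₁ x₀]`. -/
def IsLeftRay (l : SymInv X) : Prop :=
  ∃ x : ℕ → X, Function.Injective x ∧
    ∀ a b : X, b ∈ l a ↔ ∃ i, x (i + 1) = a ∧ x i = b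

/-- Basic partial injective transformations. -/
def IsBasic (η : SymInv X) : Prop :=
  (∃ k, IsCycle k η) ∨ (∃ k, IsChain k η) ∨ IsDoubleRay η ∨ IsRightRay η ∨ IsLeftRay η

/-- `D` is the set of terms of a cycle-chain-ray decomposition of `α`: a set of pairwise
completely disjoint basic transformations whose join is `α`. (There is exactly one such `D`;
for `α = 0` it is empty.) -/
def IsDecomposition (α : SymInv X) (D : Set (SymInv X)) : Prop :=
  (∀ η ∈ D, IsBasic η) ∧ D.Pairwise CompletelyDisjoint ∧
    ∀ a b : X, b ∈ α a ↔ ∃ η ∈ D, b ∈ η a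

/-- `η` is contained in `α`, that is, it occurs in the cycle-chain-ray decomposition of `α`. -/
def Contains (α η : SymInv X) : Prop := ∃ D, IsDecomposition α D ∧ η ∈ D

/-- The set `Δ_α^k` of cycles of length `k` contained in `α`. -/
def cycles (α : SymInv X) (k : ℕ) : Set (SymInv X) := {δ | Contains α δ ∧ IsCycle k δ}

/-- The set `Θ_α^k` of chains of length `k` contained in `α`. -/
def chains (α : SymInv X) (k : ℕ) : Set (SymInv X) := {θ | Contains α θ ∧ IsChain k θ}

/-- The set `Ω_α` of double rays contained in `α`. -/
def doubleRays (α : SymInv X) : Set (SymInv X) := {ω | Contains α ω ∧ IsDoubleRay ω}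

/-- The set `Υ_α` of right rays contained in `α`. -/
def rightRays (α : SymInv X) : Set (SymInv X) := {υ | Contains α υ ∧ IsRightRay υ}

/-- The set `Λ_α` of left rays contained in `α`. -/
def leftRays (α : SymInv X) : Set (SymInv X) := {l | Contains α l ∧ IsLeftRay l}

/-- `k_α = sup {k ≥ 1 : Θ_α^k ≠ ∅}`, which is `0` if there are no chains and `⊤` (for `ℵ₀`) if
the lengths of the chains are unbounded. -/
noncomputable def maxChain (α : SymInv X) : ℕ∞ :=
  ⨆ k ∈ {k : ℕ | 1 ≤ k ∧ (chains α k).Nonempty}, (k : ℕ∞)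

/-- `m_α = max {m ∈ {1, …, k_α} : |Θ_α^m| = ℵ₀}`, and `0` if there is no such `m`.
It is only used when `k_α` is a positive integer, so that the set is bounded. -/
noncomputable def maxInfChain (α : SymInv X) : ℕ :=
  sSup {m : ℕ | 1 ≤ m ∧ (m : ℕ∞) ≤ maxChain α ∧ #(chains α m) = ℵ₀}

end SymInv

/-! View `α` as a directed graph with an edge from `x` to `xα`. Its components in the span are
cycles, chains, double rays, right rays and left rays. By `cConj_iff`, `α ∼c β` means that there are
intertwiners in both directions, where an intertwiner from `α` to `β` is a partial injection `γ`
with `im α ⊆ dom γ` and `αγ = γβ`.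

Such a `γ` is defined on the whole span of `α`, sends distinct orbits into distinct orbits,
preserves periods and the number of possible forward steps exactly, and can only increase the number
of possible backward steps. So cycles go to cycles of the same length, double rays to double rays,
left rays to left rays, right rays to right or double rays, and a chain to a left ray or to a chain
at least as long. Counting orbits (`Intertwines.mk_image_le`) gives inequalities of cardinals, which
become equalities when intertwiners exist both ways. Right rays are only counted together with
double rays, and chains of length at least `k` only together with left rays; the finiteness
hypotheses are what allow the other summand to be cancelled. The numbers of chains of length at
least `k` then determine `k_α`, `m_α` and the finite counts above `m_α`.

Conversely, an injection between components that pairs each component with one it embeds into yields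
an intertwiner (`exists_intertwines`). The injection is assembled type by type: equal cardinals give
bijections, and where infinitely many targets are available a greedy choice absorbs countably many
components (`hasMatching_of_infinite`). The invariants are symmetric, so this works in both
directions. -/

namespace SymInv

/-! ### Iterates, orbits and components -/

section Iterates

variable {X : Type*} {α β γ : SymInv X} {a b c d : X} {m n k : ℕ}

theorem mem_mul : c ∈ (α * β) a ↔ ∃ b, b ∈ α a ∧ c ∈ β b := PEquiv.mem_trans α β a c

theorem mem_one : b ∈ (1 : SymInv X) a ↔ a = b := by
  change b ∈ some a ↔ a = b
  simp

theorem not_mem_zero : b ∉ (0 : SymInv X) a := by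
  change b ∉ (none : Option X)
  simp

theorem mem_pow_zero : b ∈ (α ^ 0) a ↔ a = b := by rw [pow_zero, mem_one]

theorem mem_pow_one : b ∈ (α ^ 1) a ↔ b ∈ α a := by rw [pow_one]

theorem mem_pow_add : c ∈ (α ^ (m + n)) a ↔ ∃ b, b ∈ (α ^ m) a ∧ c ∈ (α ^ n) b := by
  rw [pow_add, mem_mul]

theorem mem_pow_succ : c ∈ (α ^ (n + 1)) a ↔ ∃ b, b ∈ (α ^ n) a ∧ c ∈ α b := by
  rw [pow_succ, mem_mul]

theorem mem_pow_succ' : c ∈ (α ^ (n + 1)) a ↔ ∃ b, b ∈ α a ∧ c ∈ (α ^ n) b := by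
  rw [pow_succ', mem_mul]

theorem right_unique (hb : b ∈ α a) (hc : c ∈ α a) : b = c := Option.mem_unique hb hc

theorem left_unique (ha : c ∈ α a) (hb : c ∈ α b) : a = b := α.inj ha hb

theorem pow_trans (hb : b ∈ (α ^ m) a) (hc : c ∈ (α ^ n) b) : c ∈ (α ^ (m + n)) a :=
  mem_pow_add.2 ⟨b, hb, hc⟩

theorem pow_cancel_left (hb : b ∈ (α ^ m) a) (hc : c ∈ (α ^ (m + n)) a) : c ∈ (α ^ n) b := by
  obtain ⟨b', hb', hc'⟩ := mem_pow_add.1 hc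
  rwa [right_unique hb hb']

theorem pow_cancel_right (hb : c ∈ (α ^ n) b) (hc : c ∈ (α ^ (m + n)) a) : b ∈ (α ^ m) a := by
  obtain ⟨b', hb', hc'⟩ := mem_pow_add.1 hc
  rwa [left_unique hb hc']

theorem pow_sub_left (h : m ≤ n) (hb : b ∈ (α ^ m) a) (hc : c ∈ (α ^ n) a) :
    c ∈ (α ^ (n - m)) b := by
  obtain ⟨k, rfl⟩ := Nat.exists_eq_add_of_le h
  simpa using pow_cancel_left hb hc

theorem pow_sub_right (h : m ≤ n) (hb : c ∈ (α ^ m) b) (hc : c ∈ (α ^ n) a) :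
    b ∈ (α ^ (n - m)) a := by
  obtain ⟨k, rfl⟩ := Nat.exists_eq_add_of_le' h
  simpa using pow_cancel_right hb hc

/-- `aαⁿ` is defined. -/
def CanAdvance (α : SymInv X) (n : ℕ) (a : X) : Prop := ∃ b, b ∈ (α ^ n) a

/-- `aα⁻ⁿ` is defined. -/
def CanRetreat (α : SymInv X) (n : ℕ) (a : X) : Prop := ∃ b, a ∈ (α ^ n) b

theorem CanAdvance.mono (h : m ≤ n) (ha : CanAdvance α n a) : CanAdvance α m a := by
  obtain ⟨k, rfl⟩ := Nat.exists_eq_add_of_le h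
  obtain ⟨b, hb⟩ := ha
  obtain ⟨c, hc, -⟩ := mem_pow_add.1 hb
  exact ⟨c, hc⟩

theorem CanRetreat.mono (h : m ≤ n) (ha : CanRetreat α n a) : CanRetreat α m a := by
  obtain ⟨k, rfl⟩ := Nat.exists_eq_add_of_le' h
  obtain ⟨b, hb⟩ := ha
  obtain ⟨c, -, hc⟩ := mem_pow_add.1 hb
  exact ⟨c, hc⟩

theorem canAdvance_zero : CanAdvance α 0 a := ⟨a, mem_pow_zero.2 rfl⟩

theorem canRetreat_zero : CanRetreat α 0 a := ⟨a, mem_pow_zero.2 rfl⟩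

theorem canAdvance_one : CanAdvance α 1 a ↔ a ∈ α.dom := by
  simp only [CanAdvance, mem_pow_one]; rfl

theorem canRetreat_one : CanRetreat α 1 a ↔ a ∈ α.im := by
  simp only [CanRetreat, mem_pow_one]; rfl

theorem eq_zero_of_not_canAdvance (h : ¬ CanAdvance α 1 a) (hn : CanAdvance α n a) : n = 0 := by
  by_contra h0
  exact h (hn.mono (by omega))

theorem eq_zero_of_not_canRetreat (h : ¬ CanRetreat α 1 a) (hn : CanRetreat α n a) : n = 0 := by
  by_contra h0
  exact h (hn.mono (by omega))

/-- Two points are in the same orbit if some iterates of them coincide. -/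
def SameOrbit (α : SymInv X) (a b : X) : Prop := ∃ m n c, c ∈ (α ^ m) a ∧ c ∈ (α ^ n) b

theorem SameOrbit.refl (a : X) : SameOrbit α a a :=
  ⟨0, 0, a, mem_pow_zero.2 rfl, mem_pow_zero.2 rfl⟩

theorem SameOrbit.symm (h : SameOrbit α a b) : SameOrbit α b a := by
  obtain ⟨m, n, c, h₁, h₂⟩ := h
  exact ⟨n, m, c, h₂, h₁⟩

theorem SameOrbit.trans (h : SameOrbit α a b) (h' : SameOrbit α b c) : SameOrbit α a c := by
  obtain ⟨m, n, u, h₁, h₂⟩ := h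
  obtain ⟨p, q, v, h₃, h₄⟩ := h'
  rcases le_total n p with hnp | hnp
  · exact ⟨_, _, v, pow_trans h₁ (pow_sub_left hnp h₂ h₃), h₄⟩
  · exact ⟨_, _, u, h₁, pow_trans h₄ (pow_sub_left hnp h₃ h₂)⟩

theorem sameOrbit_of_mem (h : b ∈ (α ^ n) a) : SameOrbit α a b :=
  ⟨n, 0, b, h, mem_pow_zero.2 rfl⟩

theorem sameOrbit_of_mem_one (h : b ∈ α a) : SameOrbit α a b :=
  sameOrbit_of_mem (mem_pow_one.2 h)

/-- Injectivity cancels the shorter of the two paths to a common iterate, so one point lies ahead of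
the other. -/
theorem SameOrbit.exists_pow (h : SameOrbit α a b) : ∃ n, b ∈ (α ^ n) a ∨ a ∈ (α ^ n) b := by
  obtain ⟨m, n, c, h₁, h₂⟩ := h
  rcases le_total m n with hmn | hmn
  · exact ⟨_, .inr (pow_sub_right hmn h₁ h₂)⟩
  · exact ⟨_, .inl (pow_sub_right hmn h₂ h₁)⟩

theorem SameOrbit.mem_pow_self (h : SameOrbit α a b) (ha : a ∈ (α ^ n) a) : b ∈ (α ^ n) b := by
  obtain ⟨m, hm | hm⟩ := h.exists_pow
  · exact pow_cancel_left hm (by rw [add_comm]; exact pow_trans ha hm)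
  · exact pow_cancel_right hm (by rw [add_comm]; exact pow_trans hm ha)

theorem SameOrbit.canAdvance (h : SameOrbit α a b) (ha : ∀ n, CanAdvance α n a) (n : ℕ) :
    CanAdvance α n b := by
  obtain ⟨m, hm | hm⟩ := h.exists_pow
  · obtain ⟨c, hc⟩ := ha (m + n)
    exact ⟨c, pow_cancel_left hm hc⟩
  · obtain ⟨c, hc⟩ := ha n
    exact CanAdvance.mono (Nat.le_add_left n m) ⟨c, pow_trans hm hc⟩

theorem SameOrbit.canRetreat (h : SameOrbit α a b) (ha : ∀ n, CanRetreat α n a) (n : ℕ) :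
    CanRetreat α n b := by
  obtain ⟨m, hm | hm⟩ := h.exists_pow
  · obtain ⟨c, hc⟩ := ha n
    exact CanRetreat.mono (Nat.le_add_right n m) ⟨c, pow_trans hc hm⟩
  · obtain ⟨c, hc⟩ := ha (n + m)
    exact ⟨c, pow_cancel_right hm hc⟩

theorem SameOrbit.mem_span (h : SameOrbit α a b) (ha : a ∈ α.span) : b ∈ α.span := by
  obtain ⟨m, hm⟩ := h.exists_pow
  rcases m with _ | m
  · have : a = b := by
      rcases hm with hm | hm
      · exact mem_pow_zero.1 hm
      · exact (mem_pow_zero.1 hm).symm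
    rwa [← this]
  · rcases hm with hm | hm
    · obtain ⟨c, -, hc⟩ := mem_pow_succ.1 hm
      exact .inr ⟨c, hc⟩
    · obtain ⟨c, hc, -⟩ := mem_pow_succ'.1 hm
      exact .inl ⟨c, hc⟩

/-- The restriction of `α` to the orbit of `a`. -/
noncomputable def component (α : SymInv X) (a : X) : SymInv X :=
  letI := Classical.decPred fun c => c ∈ {c | SameOrbit α a c}
  PEquiv.ofSet {c | SameOrbit α a c} * α

theorem mem_component : c ∈ component α a b ↔ SameOrbit α a b ∧ c ∈ α b := by
  rw [component, mem_mul]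
  simp only [PEquiv.mem_ofSet_iff, Set.mem_ofPred_eq]
  constructor
  · rintro ⟨_, ⟨rfl, h⟩, h'⟩
    exact ⟨h, h'⟩
  · rintro ⟨h, h'⟩
    exact ⟨b, ⟨rfl, h⟩, h'⟩

theorem ext_mem (h : ∀ a b, b ∈ α a ↔ b ∈ β a) : α = β := by
  refine PEquiv.ext fun a => ?_
  ext b
  exact h a b

theorem SameOrbit.component_eq (h : SameOrbit α a b) : component α a = component α b :=
  ext_mem fun c d => by
    rw [mem_component, mem_component]
    exact and_congr_left fun _ => ⟨h.symm.trans, h.trans⟩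

theorem sameOrbit_of_mem_span_component (h : b ∈ (component α a).span) : SameOrbit α a b := by
  rcases h with ⟨c, hc⟩ | ⟨c, hc⟩
  · exact (mem_component.1 hc).1
  · exact (mem_component.1 hc).1.trans (sameOrbit_of_mem_one (mem_component.1 hc).2)

theorem mem_span_component (h : a ∈ α.span) : a ∈ (component α a).span := by
  rcases h with ⟨c, hc⟩ | ⟨c, hc⟩
  · exact .inl ⟨c, mem_component.2 ⟨.refl a, hc⟩⟩
  · exact .inr ⟨c, mem_component.2 ⟨(sameOrbit_of_mem_one hc).symm, hc⟩⟩

theorem sameOrbit_of_component_eq (ha : a ∈ α.span) (h : component α a = component α b) :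
    SameOrbit α a b :=
  (sameOrbit_of_mem_span_component (h ▸ mem_span_component ha)).symm

end Iterates

/-! ### Distinguished points of each type of component, and paths through them -/

section Parametrizations

variable {X : Type*} {α β η : SymInv X} {a b c d : X} {m n k : ℕ}

/-- The last points of chains of length `k`. -/
def chainEnds (α : SymInv X) (k : ℕ) : Set X :=
  {a | ¬ CanAdvance α 1 a ∧ CanRetreat α k a ∧ ¬ CanRetreat α (k + 1) a}

/-- The last points of left rays. -/
def leftEnds (α : SymInv X) : Set X := {a | ¬ CanAdvance α 1 a ∧ ∀ n, CanRetreat α n a}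

/-- The first points of right rays. -/
def rightStarts (α : SymInv X) : Set X := {a | ¬ CanRetreat α 1 a ∧ ∀ n, CanAdvance α n a}

/-- The points of double rays. -/
def doublePoints (α : SymInv X) : Set X :=
  {a | (∀ n, CanAdvance α n a) ∧ (∀ n, CanRetreat α n a) ∧ ∀ n, a ∈ (α ^ n) a → n = 0}

/-- The points of cycles of length `k`. -/
def cyclePoints (α : SymInv X) (k : ℕ) : Set X :=
  {a | 1 ≤ k ∧ a ∈ (α ^ k) a ∧ ∀ n < k, a ∈ (α ^ n) a → n = 0}

/-- `x₀, …, x_k` is a maximal path of `α`. -/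
def ChainParam (α : SymInv X) (k : ℕ) (x : ℕ → X) : Prop :=
  Set.InjOn x (Set.Iic k) ∧ (∀ i < k, x (i + 1) ∈ α (x i)) ∧ ¬ CanAdvance α 1 (x k) ∧
    ¬ CanRetreat α 1 (x 0)

/-- `x₀, x₁, …` is a maximal path of `α`. -/
def RightParam (α : SymInv X) (x : ℕ → X) : Prop :=
  Function.Injective x ∧ (∀ i, x (i + 1) ∈ α (x i)) ∧ ¬ CanRetreat α 1 (x 0)

/-- `…, x₁, x₀` is a maximal path of `α`. -/
def LeftParam (α : SymInv X) (x : ℕ → X) : Prop :=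
  Function.Injective x ∧ (∀ i, x i ∈ α (x (i + 1))) ∧ ¬ CanAdvance α 1 (x 0)

/-- `…, x₋₁, x₀, x₁, …` is a path of `α`. -/
def DoubleParam (α : SymInv X) (x : ℤ → X) : Prop :=
  Function.Injective x ∧ ∀ i, x (i + 1) ∈ α (x i)

/-- `x₀, …, x_{k-1}, x₀` is a closed path of `α`. -/
def CycleParam (α : SymInv X) (k : ℕ) (x : ℕ → X) : Prop :=
  1 ≤ k ∧ Set.InjOn x (Set.Iio k) ∧ ∀ i < k, x ((i + 1) % k) ∈ α (x i)

theorem exists_chainParam (h : a ∈ chainEnds α k) : ∃ x, ChainParam α k x ∧ x k = a := by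
  obtain ⟨h₁, ⟨b, hb⟩, h₃⟩ := h
  have key : ∀ i, ∃ y, i ≤ k → y ∈ (α ^ i) b := fun i => by
    by_cases hi : i ≤ k
    · obtain ⟨y, hy⟩ := CanAdvance.mono hi ⟨a, hb⟩
      exact ⟨y, fun _ => hy⟩
    · exact ⟨a, fun h => absurd h hi⟩
  choose x hx using key
  have hxk : x k = a := right_unique (hx k le_rfl) hb
  refine ⟨x, ⟨?_, ?_, hxk ▸ h₁, ?_⟩, hxk⟩
  -- A repetition would put `a` at two different distances ahead of the same point, so one could
  -- advance from the last point `a`.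
  · have key : ∀ i j, i < j → j ≤ k → x i ≠ x j := by
      intro i j hij hj hxx
      have h4 := pow_sub_left (hij.le.trans hj) (hx i (hij.le.trans hj)) hb
      have h5 := pow_sub_left hj (hx j hj) hb
      rw [← hxx] at h5
      have h6 := eq_zero_of_not_canAdvance h₁ ⟨_, pow_sub_left (by omega) h5 h4⟩
      omega
    intro i hi j hj hxx
    rcases lt_trichotomy i j with h | h | h
    · exact absurd hxx (key i j h hj)
    · exact h
    · exact absurd hxx.symm (key j i h hi)
  · intro i hi
    exact mem_pow_one.1 (pow_cancel_left (hx i hi.le) (hx (i + 1) hi))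
  · rintro ⟨c, hc⟩
    rw [← mem_pow_zero.1 (hx 0 (Nat.zero_le k))] at hc
    exact h₃ ⟨c, by rw [add_comm]; exact pow_trans hc hb⟩

theorem path_mem_pow {x : ℕ → X} (h : ∀ i < k, x (i + 1) ∈ α (x i)) :
    ∀ n i, i + n ≤ k → x (i + n) ∈ (α ^ n) (x i)
  | 0, _, _ => mem_pow_zero.2 rfl
  | n + 1, i, hi =>
    mem_pow_succ.2 ⟨x (i + n), path_mem_pow h n i (by omega), h (i + n) (by omega)⟩

theorem ChainParam.mem_chainEnds {x : ℕ → X} (h : ChainParam α k x) : x k ∈ chainEnds α k := by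
  obtain ⟨-, h₂, h₃, h₄⟩ := h
  have h0 := path_mem_pow h₂ k 0 (by omega)
  rw [zero_add] at h0
  refine ⟨h₃, ⟨_, h0⟩, ?_⟩
  rintro ⟨d, hd⟩
  rw [add_comm] at hd
  exact h₄ ⟨d, pow_cancel_right h0 hd⟩

theorem ChainParam.mem_component {x : ℕ → X} (h : ChainParam α k x) :
    b ∈ component α (x k) a ↔ ∃ i < k, x i = a ∧ x (i + 1) = b := by
  rw [SymInv.mem_component]
  constructor
  · rintro ⟨hs, hab⟩
    obtain ⟨-, -, hr⟩ := h.mem_chainEnds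
    obtain ⟨-, h₂, h₃, h₄⟩ := h
    obtain ⟨n, hn⟩ : ∃ n, x k ∈ (α ^ n) a := by
      obtain ⟨n, hn | hn⟩ := hs.exists_pow
      · obtain rfl := eq_zero_of_not_canAdvance h₃ ⟨a, hn⟩
        exact ⟨0, mem_pow_zero.2 (mem_pow_zero.1 hn).symm⟩
      · exact ⟨n, hn⟩
    have hnk : n ≤ k := by
      by_contra hnk
      exact hr (CanRetreat.mono (by omega) ⟨a, hn⟩)
    have hx := path_mem_pow h₂ n (k - n) (by omega)
    rw [Nat.sub_add_cancel hnk] at hx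
    have ha : x (k - n) = a := left_unique hx hn
    have hn0 : n ≠ 0 := by
      rintro rfl
      exact h₃ ⟨b, by rw [mem_pow_one, ← Nat.sub_zero k, ha]; exact hab⟩
    refine ⟨k - n, by omega, ha, ?_⟩
    exact right_unique (h₂ (k - n) (by omega)) (ha ▸ hab)
  · rintro ⟨i, hi, rfl, rfl⟩
    have hx := path_mem_pow h.2.1 (k - i) i (by omega)
    rw [Nat.add_sub_cancel' hi.le] at hx
    exact ⟨(sameOrbit_of_mem hx).symm, h.2.1 i hi⟩

theorem exists_rightParam (h : a ∈ rightStarts α) : ∃ x, RightParam α x ∧ x 0 = a := by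
  obtain ⟨h₁, h₂⟩ := h
  choose x hx using h₂
  have hx0 : x 0 = a := (mem_pow_zero.1 (hx 0)).symm
  refine ⟨x, ⟨?_, fun i => ?_, hx0 ▸ h₁⟩, hx0⟩
  · have key : ∀ i j, i < j → x i ≠ x j := by
      intro i j hij hxx
      have h3 := eq_zero_of_not_canRetreat h₁
        ⟨a, pow_sub_right hij.le (hx i) (hxx ▸ hx j)⟩
      omega
    intro i j hxx
    rcases lt_trichotomy i j with h | h | h
    · exact absurd hxx (key i j h)
    · exact h
    · exact absurd hxx.symm (key j i h)
  · exact mem_pow_one.1 (pow_cancel_left (hx i) (hx (i + 1)))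

theorem RightParam.mem_pow {x : ℕ → X} (h : RightParam α x) (n i : ℕ) :
    x (i + n) ∈ (α ^ n) (x i) :=
  path_mem_pow (fun i _ => h.2.1 i) n i le_rfl

theorem RightParam.mem_rightStarts {x : ℕ → X} (h : RightParam α x) : x 0 ∈ rightStarts α :=
  ⟨h.2.2, fun n => ⟨_, h.mem_pow n 0⟩⟩

theorem RightParam.mem_component {x : ℕ → X} (h : RightParam α x) :
    b ∈ component α (x 0) a ↔ ∃ i, x i = a ∧ x (i + 1) = b := by
  rw [SymInv.mem_component]
  constructor
  · rintro ⟨hs, hab⟩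
    obtain ⟨n, hn⟩ : ∃ n, a ∈ (α ^ n) (x 0) := by
      obtain ⟨n, hn | hn⟩ := hs.exists_pow
      · exact ⟨n, hn⟩
      · obtain rfl := eq_zero_of_not_canRetreat h.2.2 ⟨a, hn⟩
        exact ⟨0, mem_pow_zero.2 (mem_pow_zero.1 hn).symm⟩
    have hx := h.mem_pow n 0
    rw [zero_add] at hx
    have ha := right_unique hx hn
    exact ⟨n, ha, right_unique (h.2.1 n) (ha ▸ hab)⟩
  · rintro ⟨i, rfl, rfl⟩
    have hx := h.mem_pow i 0
    rw [zero_add] at hx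
    exact ⟨sameOrbit_of_mem hx, h.2.1 i⟩

theorem exists_leftParam (h : a ∈ leftEnds α) : ∃ x, LeftParam α x ∧ x 0 = a := by
  obtain ⟨h₁, h₂⟩ := h
  choose x hx using h₂
  have hx0 : x 0 = a := mem_pow_zero.1 (hx 0)
  refine ⟨x, ⟨?_, fun i => ?_, hx0 ▸ h₁⟩, hx0⟩
  · have key : ∀ i j, i < j → x i ≠ x j := by
      intro i j hij hxx
      have h3 := eq_zero_of_not_canAdvance h₁
        ⟨a, pow_sub_left hij.le (hx i) (hxx ▸ hx j)⟩
      omega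
    intro i j hxx
    rcases lt_trichotomy i j with h | h | h
    · exact absurd hxx (key i j h)
    · exact h
    · exact absurd hxx.symm (key j i h)
  · exact mem_pow_one.1 (pow_cancel_right (hx i) (by rw [add_comm]; exact hx (i + 1)))

theorem LeftParam.mem_pow {x : ℕ → X} (h : LeftParam α x) (i : ℕ) :
    ∀ n, x i ∈ (α ^ n) (x (i + n))
  | 0 => mem_pow_zero.2 rfl
  | n + 1 => mem_pow_succ'.2 ⟨x (i + n), h.2.1 (i + n), h.mem_pow i n⟩

theorem LeftParam.mem_leftEnds {x : ℕ → X} (h : LeftParam α x) : x 0 ∈ leftEnds α :=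
  ⟨h.2.2, fun n => ⟨_, h.mem_pow 0 n⟩⟩

theorem LeftParam.mem_component {x : ℕ → X} (h : LeftParam α x) :
    b ∈ component α (x 0) a ↔ ∃ i, x (i + 1) = a ∧ x i = b := by
  rw [SymInv.mem_component]
  constructor
  · rintro ⟨hs, hab⟩
    obtain ⟨n, hn⟩ : ∃ n, x 0 ∈ (α ^ n) b := by
      obtain ⟨n, hn | hn⟩ := (hs.trans (sameOrbit_of_mem_one hab)).exists_pow
      · obtain rfl := eq_zero_of_not_canAdvance h.2.2 ⟨b, hn⟩
        exact ⟨0, mem_pow_zero.2 (mem_pow_zero.1 hn).symm⟩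
      · exact ⟨n, hn⟩
    have hx := h.mem_pow 0 n
    rw [zero_add] at hx
    have hb := left_unique hx hn
    exact ⟨n, left_unique (h.2.1 n) (hb ▸ hab), hb⟩
  · rintro ⟨i, rfl, rfl⟩
    have hx := h.mem_pow 0 (i + 1)
    rw [zero_add] at hx
    exact ⟨(sameOrbit_of_mem hx).symm, h.2.1 i⟩

theorem exists_doubleParam (h : a ∈ doublePoints α) : ∃ x, DoubleParam α x ∧ x 0 = a := by
  obtain ⟨h₁, h₂, h₃⟩ := h
  choose f hf using h₁
  choose g hg using h₂
  let x : ℤ → X := fun z => if 0 ≤ z then f z.toNat else g (-z).toNat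
  -- Measuring from a point `g n` far enough back makes all exponents natural numbers; below, `n =
  -- i.natAbs` suffices for every index compared with `i`.
  have hx : ∀ z : ℤ, ∀ n : ℕ, 0 ≤ n + z → x z ∈ (α ^ (n + z).toNat) (g n) := by
    intro z n hz
    by_cases h0 : 0 ≤ z
    · have e : (n + z).toNat = n + z.toNat := by omega
      simp only [x, h0, if_true, e]
      exact pow_trans (hg n) (hf _)
    · have e : n = (n + z).toNat + (-z).toNat := by omega
      simp only [x, h0, if_false]
      refine pow_cancel_right (hg (-z).toNat) ?_
      rw [← e]
      exact hg n
  refine ⟨x, ⟨?_, fun i => ?_⟩, ?_⟩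
  · have key : ∀ i j : ℤ, i < j → x i ≠ x j := by
      intro i j hij hxx
      have h4 := hx i i.natAbs (by omega)
      have h5 := hx j i.natAbs (by omega)
      rw [← hxx] at h5
      have h6 := pow_sub_left (by omega) h4 h5
      have h7 : SameOrbit α (x i) a :=
        (sameOrbit_of_mem h4).symm.trans (sameOrbit_of_mem (hg _))
      have := h₃ _ (h7.mem_pow_self h6)
      omega
    intro i j hxx
    rcases lt_trichotomy i j with h | h | h
    · exact absurd hxx (key i j h)
    · exact h
    · exact absurd hxx.symm (key j i h)
  · have h4 := hx i i.natAbs (by omega)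
    have h5 := hx (i + 1) i.natAbs (by omega)
    have e : ((i.natAbs : ℤ) + (i + 1)).toNat = ((i.natAbs : ℤ) + i).toNat + 1 := by omega
    rw [e] at h5
    exact mem_pow_one.1 (pow_cancel_left h4 h5)
  · simp only [x, le_refl, if_true]
    exact (mem_pow_zero.1 (hf 0)).symm

theorem DoubleParam.mem_pow {x : ℤ → X} (h : DoubleParam α x) (i : ℤ) :
    ∀ n : ℕ, x (i + n) ∈ (α ^ n) (x i)
  | 0 => mem_pow_zero.2 (by simp)
  | n + 1 => mem_pow_succ.2 ⟨_, h.mem_pow i n, by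
      have := h.2 (i + n)
      rwa [add_assoc] at this⟩

theorem DoubleParam.mem_doublePoints {x : ℤ → X} (h : DoubleParam α x) :
    x 0 ∈ doublePoints α := by
  refine ⟨fun n => ⟨_, h.mem_pow 0 n⟩, fun n => ⟨x (-n), ?_⟩, fun n hn => ?_⟩
  · have := h.mem_pow (-n) n
    rwa [neg_add_cancel] at this
  · have := h.1 (right_unique (h.mem_pow 0 n) hn)
    omega

theorem DoubleParam.mem_component {x : ℤ → X} (h : DoubleParam α x) :
    b ∈ component α (x 0) a ↔ ∃ i, x i = a ∧ x (i + 1) = b := by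
  rw [SymInv.mem_component]
  constructor
  · rintro ⟨hs, hab⟩
    obtain ⟨i, hi⟩ : ∃ i, x i = a := by
      obtain ⟨n, hn | hn⟩ := hs.exists_pow
      · exact ⟨_, right_unique (h.mem_pow 0 n) hn⟩
      · have := h.mem_pow (-n) n
        rw [neg_add_cancel] at this
        exact ⟨_, left_unique this hn⟩
    exact ⟨i, hi, right_unique (h.2 i) (hi ▸ hab)⟩
  · rintro ⟨i, rfl, rfl⟩
    refine ⟨?_, h.2 i⟩
    have h1 := h.mem_pow (-i.natAbs) i.natAbs
    have h2 := h.mem_pow (-i.natAbs) (i + i.natAbs).toNat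
    rw [neg_add_cancel] at h1
    rw [show -(i.natAbs : ℤ) + (i + i.natAbs).toNat = i by omega] at h2
    exact (sameOrbit_of_mem h1).symm.trans (sameOrbit_of_mem h2)

theorem exists_cycleParam (h : a ∈ cyclePoints α k) : ∃ x, CycleParam α k x ∧ x 0 = a := by
  obtain ⟨h₁, h₂, h₃⟩ := h
  have key : ∀ i, ∃ y, i ≤ k → y ∈ (α ^ i) a := fun i => by
    by_cases hi : i ≤ k
    · obtain ⟨y, hy⟩ := CanAdvance.mono hi ⟨a, h₂⟩
      exact ⟨y, fun _ => hy⟩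
    · exact ⟨a, fun h => absurd h hi⟩
  choose x hx using key
  have hx0 : x 0 = a := (mem_pow_zero.1 (hx 0 (Nat.zero_le k))).symm
  refine ⟨x, ⟨h₁, ?_, ?_⟩, hx0⟩
  · have key : ∀ i j, i < j → j < k → x i ≠ x j := by
      intro i j hij hj hxx
      have h4 := hx j hj.le
      rw [← hxx] at h4
      have := h₃ _ (by omega) (pow_sub_right hij.le (hx i (hij.le.trans hj.le)) h4)
      omega
    intro i hi j hj hxx
    rcases lt_trichotomy i j with h | h | h
    · exact absurd hxx (key i j h hj)
    · exact h
    · exact absurd hxx.symm (key j i h hi)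
  · intro i hi
    have h5 := mem_pow_one.1 (pow_cancel_left (hx i hi.le) (hx (i + 1) hi))
    rcases Nat.lt_or_ge (i + 1) k with h | h
    · rwa [Nat.mod_eq_of_lt h]
    · obtain rfl : i + 1 = k := by omega
      rw [Nat.mod_self, hx0]
      rwa [right_unique (hx (i + 1) le_rfl) h₂] at h5

theorem CycleParam.mem_pow {x : ℕ → X} (h : CycleParam α k x) :
    ∀ n : ℕ, x (n % k) ∈ (α ^ n) (x 0)
  | 0 => mem_pow_zero.2 (by simp)
  | n + 1 => mem_pow_succ.2 ⟨_, h.mem_pow n, by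
      have := h.2.2 (n % k) (Nat.mod_lt _ h.1)
      rwa [Nat.mod_add_mod] at this⟩

theorem CycleParam.mem_cyclePoints {x : ℕ → X} (h : CycleParam α k x) :
    x 0 ∈ cyclePoints α k := by
  refine ⟨h.1, ?_, fun n hn hx => ?_⟩
  · simpa using h.mem_pow k
  · have := h.mem_pow n
    rw [Nat.mod_eq_of_lt hn] at this
    exact h.2.1 hn h.1 (right_unique this hx)

theorem CycleParam.mem_component {x : ℕ → X} (h : CycleParam α k x) :
    b ∈ component α (x 0) a ↔ ∃ i < k, x i = a ∧ x ((i + 1) % k) = b := by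
  rw [SymInv.mem_component]
  constructor
  · rintro ⟨hs, hab⟩
    obtain ⟨i, hi⟩ : ∃ i, x (i % k) = a := by
      obtain ⟨n, hn | hn⟩ := hs.exists_pow
      · exact ⟨_, right_unique (h.mem_pow n) hn⟩
      -- If `a` lies `n` steps behind `x 0`, going round the cycle `n` times reaches `a` by `k * n -
      -- n` forward steps.
      · have h1 := h.mem_pow (k * n)
        have hle : n ≤ k * n := Nat.le_mul_of_pos_left n h.1
        rw [Nat.mul_mod_right] at h1
        exact ⟨_, right_unique (h.mem_pow _) (pow_sub_right hle hn h1)⟩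
    have hlt := Nat.mod_lt i h.1
    exact ⟨i % k, hlt, hi, right_unique (h.2.2 _ hlt) (hi ▸ hab)⟩
  · rintro ⟨i, hi, rfl, rfl⟩
    have h1 := h.mem_pow i
    rw [Nat.mod_eq_of_lt hi] at h1
    exact ⟨sameOrbit_of_mem h1, h.2.2 i hi⟩

end Parametrizations

/-! ### The components form the cycle-chain-ray decomposition -/

section Decomposition

variable {X : Type*} {α β η : SymInv X} {a b c d : X} {m n k : ℕ}

theorem exists_last (h : ¬ ∀ n, CanAdvance α n a) :
    ∃ b, SameOrbit α a b ∧ ¬ CanAdvance α 1 b := by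
  push Not at h
  classical
  let n := Nat.find h
  have hn : ¬ CanAdvance α n a := Nat.find_spec h
  have hn0 : n ≠ 0 := fun h0 => hn (h0 ▸ canAdvance_zero)
  obtain ⟨b, hb⟩ : CanAdvance α (n - 1) a := not_not.1 (Nat.find_min h (m := n - 1) (by omega))
  refine ⟨b, sameOrbit_of_mem hb, ?_⟩
  rintro ⟨c, hc⟩
  refine hn ⟨c, ?_⟩
  have := pow_trans hb hc
  rwa [Nat.sub_add_cancel (by omega)] at this

theorem exists_first (h : ¬ ∀ n, CanRetreat α n a) :
    ∃ b, SameOrbit α a b ∧ ¬ CanRetreat α 1 b := by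
  push Not at h
  classical
  let n := Nat.find h
  have hn : ¬ CanRetreat α n a := Nat.find_spec h
  have hn0 : n ≠ 0 := fun h0 => hn (h0 ▸ canRetreat_zero)
  obtain ⟨b, hb⟩ : CanRetreat α (n - 1) a := not_not.1 (Nat.find_min h (m := n - 1) (by omega))
  refine ⟨b, (sameOrbit_of_mem hb).symm, ?_⟩
  rintro ⟨c, hc⟩
  refine hn ⟨c, ?_⟩
  have := pow_trans hc hb
  rwa [Nat.add_sub_cancel' (by omega)] at this

theorem mem_chainEnds_of_last (ha : a ∈ α.span) (h : ¬ CanAdvance α 1 a)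
    (h' : ¬ ∀ n, CanRetreat α n a) : ∃ k, 1 ≤ k ∧ a ∈ chainEnds α k := by
  push Not at h'
  classical
  let n := Nat.find h'
  have hn : ¬ CanRetreat α n a := Nat.find_spec h'
  -- A last point of the span lies in the image, so the resulting chain has positive length.
  have h1 : CanRetreat α 1 a := canRetreat_one.2 <| ha.resolve_left fun h0 =>
    h (canAdvance_one.2 h0)
  have hn0 : 1 < n := by
    by_contra h0
    exact hn (h1.mono (by omega))
  refine ⟨n - 1, by omega, h, not_not.1 (Nat.find_min h' (m := n - 1) (by omega)), ?_⟩
  rwa [Nat.sub_add_cancel (by omega)]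

theorem exists_mem_cyclePoints (hn : n ≠ 0) (h : a ∈ (α ^ n) a) : ∃ k, a ∈ cyclePoints α k := by
  classical
  have hex : ∃ n, n ≠ 0 ∧ a ∈ (α ^ n) a := ⟨n, hn, h⟩
  refine ⟨Nat.find hex, Nat.one_le_iff_ne_zero.2 (Nat.find_spec hex).1, (Nat.find_spec hex).2,
    fun m hm hma => ?_⟩
  by_contra hm0
  exact Nat.find_min hex hm ⟨hm0, hma⟩

/-- The type is decided by whether all forward and all backward iterates exist, and, if both do, by
periodicity. -/
theorem exists_basePoint (ha : a ∈ α.span) : ∃ b, SameOrbit α a b ∧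
    (b ∈ leftEnds α ∨ (∃ k, 1 ≤ k ∧ b ∈ chainEnds α k) ∨ b ∈ rightStarts α ∨
      b ∈ doublePoints α ∨ ∃ k, b ∈ cyclePoints α k) := by
  by_cases h₁ : ∀ n, CanAdvance α n a
  · by_cases h₂ : ∀ n, CanRetreat α n a
    · by_cases h₃ : ∀ n, a ∈ (α ^ n) a → n = 0
      · exact ⟨a, .refl a, .inr (.inr (.inr (.inl ⟨h₁, h₂, h₃⟩)))⟩
      · push Not at h₃
        obtain ⟨n, hn, hn0⟩ := h₃
        exact ⟨a, .refl a, .inr (.inr (.inr (.inr (exists_mem_cyclePoints hn0 hn))))⟩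
    · obtain ⟨b, hb, hb'⟩ := exists_first h₂
      exact ⟨b, hb, .inr (.inr (.inl ⟨hb', hb.canAdvance h₁⟩))⟩
  · obtain ⟨b, hb, hb'⟩ := exists_last h₁
    by_cases h₂ : ∀ n, CanRetreat α n b
    · exact ⟨b, hb, .inl ⟨hb', h₂⟩⟩
    · exact ⟨b, hb, .inr (.inl (mem_chainEnds_of_last (hb.mem_span ha) hb' h₂))⟩

theorem isChain_component (hk : 1 ≤ k) (h : a ∈ chainEnds α k) :
    IsChain k (component α a) := by
  obtain ⟨x, hx, rfl⟩ := exists_chainParam h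
  exact ⟨hk, x, hx.1, fun _ _ => hx.mem_component⟩

theorem isLeftRay_component (h : a ∈ leftEnds α) : IsLeftRay (component α a) := by
  obtain ⟨x, hx, rfl⟩ := exists_leftParam h
  exact ⟨x, hx.1, fun _ _ => hx.mem_component⟩

theorem isRightRay_component (h : a ∈ rightStarts α) : IsRightRay (component α a) := by
  obtain ⟨x, hx, rfl⟩ := exists_rightParam h
  exact ⟨x, hx.1, fun _ _ => hx.mem_component⟩

theorem isDoubleRay_component (h : a ∈ doublePoints α) : IsDoubleRay (component α a) := by
  obtain ⟨x, hx, rfl⟩ := exists_doubleParam h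
  exact ⟨x, hx.1, fun _ _ => hx.mem_component⟩

theorem isCycle_component (h : a ∈ cyclePoints α k) : IsCycle k (component α a) := by
  obtain ⟨x, hx, rfl⟩ := exists_cycleParam h
  exact ⟨hx.1, x, hx.2.1, fun _ _ => hx.mem_component⟩

theorem isBasic_component (ha : a ∈ α.span) : IsBasic (component α a) := by
  obtain ⟨b, hab, h⟩ := exists_basePoint ha
  rw [hab.component_eq]
  rcases h with h | ⟨k, hk, h⟩ | h | h | ⟨k, h⟩
  · exact .inr (.inr (.inr (.inr (isLeftRay_component h))))
  · exact .inr (.inl ⟨k, isChain_component hk h⟩)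
  · exact .inr (.inr (.inr (.inl (isRightRay_component h))))
  · exact .inr (.inr (.inl (isDoubleRay_component h)))
  · exact .inl ⟨k, isCycle_component h⟩

theorem isDecomposition_components (α : SymInv X) :
    IsDecomposition α (component α '' α.span) := by
  refine ⟨?_, ?_, fun a b => ?_⟩
  · rintro _ ⟨a, ha, rfl⟩
    exact isBasic_component ha
  · rintro _ ⟨a, ha, rfl⟩ _ ⟨b, hb, rfl⟩ hab
    refine Set.eq_empty_iff_forall_notMem.2 fun c hc => hab ?_
    exact ((sameOrbit_of_mem_span_component hc.1).trans
      (sameOrbit_of_mem_span_component hc.2).symm).component_eq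
  · constructor
    · intro h
      exact ⟨_, ⟨a, .inl ⟨b, h⟩, rfl⟩, mem_component.2 ⟨.refl a, h⟩⟩
    · rintro ⟨_, ⟨c, -, rfl⟩, h⟩
      exact (mem_component.1 h).2

theorem contains_component (ha : a ∈ α.span) : Contains α (component α a) :=
  ⟨_, isDecomposition_components α, a, ha, rfl⟩

theorem Contains.mem (h : Contains α η) (hb : b ∈ η a) : b ∈ α a := by
  obtain ⟨D, hD, hη⟩ := h
  exact (hD.2.2 a b).2 ⟨η, hη, hb⟩

/-- The term of the decomposition carrying the edge from `a` to `b` meets the span of `η`, so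
complete disjointness makes it `η`. -/
theorem Contains.mem_of_left (h : Contains α η) (ha : a ∈ η.span) (hb : b ∈ α a) : b ∈ η a := by
  obtain ⟨D, hD, hη⟩ := h
  obtain ⟨θ, hθ, hab⟩ := (hD.2.2 a b).1 hb
  by_cases he : η = θ
  · rwa [he]
  · exact absurd (show a ∈ η.span ∩ θ.span from ⟨ha, .inl ⟨b, hab⟩⟩)
      (by rw [hD.2.1 hη hθ he]; exact id)

theorem Contains.mem_of_right (h : Contains α η) (hb : b ∈ η.span) (hab : b ∈ α a) :
    b ∈ η a := by
  obtain ⟨D, hD, hη⟩ := h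
  obtain ⟨θ, hθ, hab⟩ := (hD.2.2 a b).1 hab
  by_cases he : η = θ
  · rwa [he]
  · exact absurd (show b ∈ η.span ∩ θ.span from ⟨hb, .inr ⟨a, hab⟩⟩)
      (by rw [hD.2.1 hη hθ he]; exact id)

theorem mem_span_of_chainEnds (hk : 1 ≤ k) (h : a ∈ chainEnds α k) : a ∈ α.span :=
  .inr (canRetreat_one.1 (h.2.1.mono hk))

theorem mem_span_of_leftEnds (h : a ∈ leftEnds α) : a ∈ α.span :=
  .inr (canRetreat_one.1 (h.2 1))

theorem mem_span_of_rightStarts (h : a ∈ rightStarts α) : a ∈ α.span :=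
  .inl (canAdvance_one.1 (h.2 1))

theorem mem_span_of_doublePoints (h : a ∈ doublePoints α) : a ∈ α.span :=
  .inl (canAdvance_one.1 (h.1 1))

theorem mem_span_of_cyclePoints (h : a ∈ cyclePoints α k) : a ∈ α.span :=
  .inl (canAdvance_one.1 (CanAdvance.mono h.1 ⟨a, h.2.1⟩))

/-- A contained chain cannot be prolonged inside `α`, so its points form a maximal path and it is
the component of its last point. This and its analogues for the other types replace the existential
over decompositions by orbits, making uniqueness of the decomposition unnecessary. -/
theorem chains_eq (hk : 1 ≤ k) : chains α k = component α '' chainEnds α k := by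
  refine Set.Subset.antisymm ?_ ?_
  · rintro θ ⟨hc, -, x, hx, hθ⟩
    have step : ∀ i < k, x (i + 1) ∈ θ (x i) := fun i hi => (hθ _ _).2 ⟨i, hi, rfl, rfl⟩
    have hp : ChainParam α k x := by
      refine ⟨hx, fun i hi => hc.mem (step i hi), fun h => ?_, fun h => ?_⟩
      · obtain ⟨b, hb⟩ := h
        have hs : x k ∈ θ.span := .inr ⟨x (k - 1), by
          have := step (k - 1) (by omega)
          rwa [Nat.sub_add_cancel hk] at this⟩
        obtain ⟨i, hi, hxx, -⟩ := (hθ _ _).1 (hc.mem_of_left hs (mem_pow_one.1 hb))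
        exact hi.ne (hx (Set.mem_Iic.2 hi.le) (Set.mem_Iic.2 le_rfl) hxx)
      · obtain ⟨b, hb⟩ := h
        have hs : x 0 ∈ θ.span := .inl ⟨x 1, step 0 (by omega)⟩
        obtain ⟨i, hi, -, hxx⟩ := (hθ _ _).1 (hc.mem_of_right hs (mem_pow_one.1 hb))
        exact absurd (hx (Set.mem_Iic.2 hi) (Set.mem_Iic.2 (Nat.zero_le k)) hxx) (by omega)
    exact ⟨x k, hp.mem_chainEnds, ext_mem fun a b => by rw [hp.mem_component, hθ]⟩
  · rintro _ ⟨a, ha, rfl⟩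
    exact ⟨contains_component (mem_span_of_chainEnds hk ha), isChain_component hk ha⟩

theorem leftRays_eq : leftRays α = component α '' leftEnds α := by
  refine Set.Subset.antisymm ?_ ?_
  · rintro θ ⟨hc, x, hx, hθ⟩
    have step : ∀ i, x i ∈ θ (x (i + 1)) := fun i => (hθ _ _).2 ⟨i, rfl, rfl⟩
    have hp : LeftParam α x := by
      refine ⟨hx, fun i => hc.mem (step i), fun h => ?_⟩
      obtain ⟨b, hb⟩ := h
      obtain ⟨i, hxx, -⟩ :=
        (hθ _ _).1 (hc.mem_of_left (.inr ⟨x 1, step 0⟩) (mem_pow_one.1 hb))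
      exact absurd (hx hxx) (by omega)
    exact ⟨x 0, hp.mem_leftEnds, ext_mem fun a b => by rw [hp.mem_component, hθ]⟩
  · rintro _ ⟨a, ha, rfl⟩
    exact ⟨contains_component (mem_span_of_leftEnds ha), isLeftRay_component ha⟩

theorem rightRays_eq : rightRays α = component α '' rightStarts α := by
  refine Set.Subset.antisymm ?_ ?_
  · rintro θ ⟨hc, x, hx, hθ⟩
    have step : ∀ i, x (i + 1) ∈ θ (x i) := fun i => (hθ _ _).2 ⟨i, rfl, rfl⟩
    have hp : RightParam α x := by
      refine ⟨hx, fun i => hc.mem (step i), fun h => ?_⟩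
      obtain ⟨b, hb⟩ := h
      obtain ⟨i, -, hxx⟩ :=
        (hθ _ _).1 (hc.mem_of_right (.inl ⟨x 1, step 0⟩) (mem_pow_one.1 hb))
      exact absurd (hx hxx) (by omega)
    exact ⟨x 0, hp.mem_rightStarts, ext_mem fun a b => by rw [hp.mem_component, hθ]⟩
  · rintro _ ⟨a, ha, rfl⟩
    exact ⟨contains_component (mem_span_of_rightStarts ha), isRightRay_component ha⟩

theorem doubleRays_eq : doubleRays α = component α '' doublePoints α := by
  refine Set.Subset.antisymm ?_ ?_
  · rintro θ ⟨hc, x, hx, hθ⟩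
    have hp : DoubleParam α x := ⟨hx, fun i => hc.mem ((hθ _ _).2 ⟨i, rfl, rfl⟩)⟩
    exact ⟨x 0, hp.mem_doublePoints, ext_mem fun a b => by rw [hp.mem_component, hθ]⟩
  · rintro _ ⟨a, ha, rfl⟩
    exact ⟨contains_component (mem_span_of_doublePoints ha), isDoubleRay_component ha⟩

theorem cycles_eq : cycles α k = component α '' cyclePoints α k := by
  refine Set.Subset.antisymm ?_ ?_
  · rintro θ ⟨hc, hk, x, hx, hθ⟩
    have hp : CycleParam α k x :=
      ⟨hk, hx, fun i hi => hc.mem ((hθ _ _).2 ⟨i, hi, rfl, rfl⟩)⟩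
    exact ⟨x 0, hp.mem_cyclePoints, ext_mem fun a b => by rw [hp.mem_component, hθ]⟩
  · rintro _ ⟨a, ha, rfl⟩
    exact ⟨contains_component (mem_span_of_cyclePoints ha), isCycle_component ha⟩

end Decomposition

/-! ### Intertwiners as embeddings of components -/

section Embedding

variable {X : Type*} {α β γ : SymInv X} {a b c d s t : X} {m n k : ℕ}

/-- `γ` restricts to an embedding of the functional digraph of `α` into that of `β` which
maps last points to last points. -/
def Intertwines (α β γ : SymInv X) : Prop := α.im ⊆ γ.dom ∧ α * γ = γ * β

theorem eq_zero_iff : α = 0 ↔ ∀ a b, b ∉ α a :=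
  ⟨fun h _ _ hb => not_mem_zero (h ▸ hb),
    fun h => ext_mem fun a b => iff_of_false (h a b) not_mem_zero⟩

/-- Testing with `μ` the identity on one point `x` isolates a single edge from `x` to `y`, which
survives multiplication by `γ` only if `y ∈ dom γ`. -/
theorem mem_conjugatorSet (hα : α ≠ 0) : γ ∈ conjugatorSet α ↔ α.im ⊆ γ.dom := by
  constructor
  · rintro ⟨-, h⟩ y ⟨x, hxy⟩
    classical
    have hμ : ∀ a b, b ∈ (PEquiv.single x x * α : SymInv X) a ↔ a = x ∧ b = y := by
      intro a b
      rw [mem_mul]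
      simp only [PEquiv.mem_single_iff]
      constructor
      · rintro ⟨_, ⟨rfl, rfl⟩, hb⟩
        exact ⟨rfl, right_unique hb hxy⟩
      · rintro ⟨rfl, rfl⟩
        exact ⟨_, ⟨rfl, rfl⟩, hxy⟩
    have h1 := h hα (PEquiv.single x x) fun h0 =>
      eq_zero_iff.1 h0 x y ((hμ x y).2 ⟨rfl, rfl⟩)
    by_contra hy
    refine h1 (eq_zero_iff.2 fun a c hc => ?_)
    obtain ⟨b, hb, hc⟩ := mem_mul.1 hc
    exact hy ⟨c, ((hμ a b).1 hb).2 ▸ hc⟩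
  · intro h
    refine ⟨fun h0 => absurd h0 hα, fun _ μ hμ h0 => hμ (eq_zero_iff.2 fun a b hb => ?_)⟩
    obtain ⟨d, -, hd⟩ := mem_mul.1 hb
    obtain ⟨c, hc⟩ := h ⟨d, hd⟩
    exact eq_zero_iff.1 h0 a c (mem_mul.2 ⟨b, hb, hc⟩)

theorem mem_conjugatorSetOne (hα : α ≠ 0) : γ ∈ conjugatorSetOne α ↔ α.im ⊆ γ.dom := by
  rw [conjugatorSetOne, Set.mem_union, mem_conjugatorSet hα, or_iff_left_iff_imp]
  rintro rfl a -
  exact ⟨a, mem_one.2 rfl⟩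

/-- For nonzero elements adjoining `1` changes nothing, since `1` is total. The zero element needs
care because `ℙ(0) = {0}`, but an intertwiner from `β` to `0` already forces `β = 0`. -/
theorem cConj_iff :
    CConj α β ↔ (∃ γ, Intertwines α β γ) ∧ ∃ γ, Intertwines β α γ := by
  have im_zero : (0 : SymInv X).im = ∅ :=
    Set.eq_empty_iff_forall_notMem.2 fun y ⟨x, h⟩ => not_mem_zero h
  have intertwines_zero : ∀ {β : SymInv X}, (∃ γ, Intertwines β 0 γ) → β = 0 := by
    rintro β ⟨γ, h, h'⟩
    refine eq_zero_iff.2 fun a b hb => ?_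
    obtain ⟨c, hc⟩ := h ⟨a, hb⟩
    rw [mul_zero] at h'
    exact eq_zero_iff.1 h' a c (mem_mul.2 ⟨b, hb, hc⟩)
  by_cases hα : α = 0
  · subst hα
    constructor
    · rintro ⟨g, hg, h, hh, h₁, h₂⟩
      have hβ : β = 0 := by
        by_contra hβ
        rw [mem_conjugatorSetOne hβ] at hh
        exact hβ (intertwines_zero ⟨h, hh, h₂⟩)
      subst hβ
      exact ⟨⟨0, by simp [im_zero], rfl⟩, ⟨0, by simp [im_zero], rfl⟩⟩
    · rintro ⟨-, h⟩
      obtain rfl := intertwines_zero h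
      exact ⟨1, .inr rfl, 1, .inr rfl, by simp, by simp⟩
  · by_cases hβ : β = 0
    · subst hβ
      constructor
      · rintro ⟨g, hg, h, hh, h₁, h₂⟩
        rw [mem_conjugatorSetOne hα] at hg
        exact absurd (intertwines_zero ⟨g, hg, h₁⟩) hα
      · rintro ⟨h, -⟩
        exact absurd (intertwines_zero h) hα
    · constructor
      · rintro ⟨g, hg, h, hh, h₁, h₂⟩
        exact ⟨⟨g, (mem_conjugatorSetOne hα).1 hg, h₁⟩, ⟨h, (mem_conjugatorSetOne hβ).1 hh, h₂⟩⟩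
      · rintro ⟨⟨g, hg, h₁⟩, ⟨h, hh, h₂⟩⟩
        exact ⟨g, (mem_conjugatorSetOne hα).2 hg, h, (mem_conjugatorSetOne hβ).2 hh, h₁, h₂⟩

theorem Intertwines.exists_of_mem_span (h : Intertwines α β γ) (ha : a ∈ α.span) :
    ∃ c, c ∈ γ a := by
  rcases ha with ⟨b, hb⟩ | ha
  · obtain ⟨c, hc⟩ := h.1 ⟨a, hb⟩
    have : c ∈ (γ * β) a := h.2 ▸ mem_mul.2 ⟨b, hb, hc⟩
    obtain ⟨d, hd, -⟩ := mem_mul.1 this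
    exact ⟨d, hd⟩
  · exact h.1 ha

theorem Intertwines.pow_right (h : Intertwines α β γ) (hc : c ∈ γ a) :
    ∀ {n b}, b ∈ (α ^ n) a → ∃ d, d ∈ γ b ∧ d ∈ (β ^ n) c
  | 0, b, hb => ⟨c, mem_pow_zero.1 hb ▸ hc, mem_pow_zero.2 rfl⟩
  | n + 1, b, hb => by
    obtain ⟨b', hb', hb⟩ := mem_pow_succ.1 hb
    obtain ⟨d', hd', hd⟩ := h.pow_right hc hb'
    obtain ⟨e, he⟩ := h.1 ⟨b', hb⟩
    have : e ∈ (γ * β) b' := h.2 ▸ mem_mul.2 ⟨b, hb, he⟩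
    obtain ⟨f, hf, hfe⟩ := mem_mul.1 this
    obtain rfl := right_unique hf hd'
    exact ⟨e, he, mem_pow_succ.2 ⟨f, hd, hfe⟩⟩

theorem Intertwines.pow_left (h : Intertwines α β γ) (hc : c ∈ γ a) :
    ∀ {n d}, d ∈ (β ^ n) c → ∃ b, b ∈ (α ^ n) a ∧ d ∈ γ b
  | 0, d, hd => ⟨a, mem_pow_zero.2 rfl, mem_pow_zero.1 hd ▸ hc⟩
  | n + 1, d, hd => by
    obtain ⟨d', hd', hd⟩ := mem_pow_succ.1 hd
    obtain ⟨b', hb', hb⟩ := h.pow_left hc hd'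
    have : d ∈ (α * γ) b' := h.2 ▸ mem_mul.2 ⟨d', hb, hd⟩
    obtain ⟨b, hb, hbd⟩ := mem_mul.1 this
    exact ⟨b, mem_pow_succ.2 ⟨b', hb', hb⟩, hbd⟩

theorem Intertwines.canAdvance_iff (h : Intertwines α β γ) (hc : c ∈ γ a) :
    CanAdvance β n c ↔ CanAdvance α n a := by
  constructor
  · rintro ⟨d, hd⟩
    obtain ⟨b, hb, -⟩ := h.pow_left hc hd
    exact ⟨b, hb⟩
  · rintro ⟨b, hb⟩
    obtain ⟨d, -, hd⟩ := h.pow_right hc hb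
    exact ⟨d, hd⟩

/-- With `n ≠ 0` the starting point of the path lies in the span, so `γ` is defined there and the
path can be pushed forward. -/
theorem Intertwines.canRetreat (h : Intertwines α β γ) (hc : c ∈ γ a) (hn : n ≠ 0)
    (ha : CanRetreat α n a) : CanRetreat β n c := by
  obtain ⟨b, hb⟩ := ha
  obtain ⟨d, hd⟩ := h.exists_of_mem_span (canAdvance_one.1
    (CanAdvance.mono (by omega) ⟨a, hb⟩) |> Or.inl : b ∈ α.span)
  obtain ⟨c', hc', hd'⟩ := h.pow_right hd hb
  obtain rfl := right_unique hc hc'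
  exact ⟨d, hd'⟩

theorem Intertwines.mem_pow_self_iff (h : Intertwines α β γ) (hc : c ∈ γ a) :
    c ∈ (β ^ n) c ↔ a ∈ (α ^ n) a := by
  constructor
  · intro hn
    obtain ⟨b, hb, hbc⟩ := h.pow_left hc hn
    rwa [left_unique hbc hc] at hb
  · intro hn
    obtain ⟨d, hd, hdc⟩ := h.pow_right hc hn
    rwa [right_unique hd hc] at hdc

/-- A common iterate of `c` and `d` pulls back along both paths, and injectivity of `γ` identifies
the two preimages. -/
theorem Intertwines.sameOrbit (h : Intertwines α β γ) (hc : c ∈ γ a) (hd : d ∈ γ b)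
    (hs : SameOrbit β c d) : SameOrbit α a b := by
  obtain ⟨m, n, e, h₁, h₂⟩ := hs
  obtain ⟨u, hu, hue⟩ := h.pow_left hc h₁
  obtain ⟨v, hv, hve⟩ := h.pow_left hd h₂
  obtain rfl := left_unique hue hve
  exact ⟨m, n, u, hu, hv⟩

/-- If `γ` maps `S` into `T`, then there are at most as many orbits of `β` meeting `T` as
orbits of `α` meeting `S`. -/
theorem Intertwines.mk_image_le (h : Intertwines α β γ) {S T : Set X} (hS : S ⊆ α.span)
    (hT : T ⊆ β.span) (hST : ∀ a ∈ S, ∀ c ∈ γ a, c ∈ T) :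
    #(component α '' S) ≤ #(component β '' T) := by
  have key : ∀ η : component α '' S, ∃ a c, a ∈ S ∧ component α a = η ∧ c ∈ γ a := by
    rintro ⟨_, a, ha, rfl⟩
    obtain ⟨c, hc⟩ := h.exists_of_mem_span (hS ha)
    exact ⟨a, c, ha, rfl, hc⟩
  choose f g hf hfη hg using key
  refine mk_le_of_injective
    (f := fun η => (⟨component β (g η), g η, hST _ (hf η) _ (hg η), rfl⟩ :
      component β '' T)) fun η θ hηθ => ?_
  have h1 := sameOrbit_of_component_eq (hT (hST _ (hf η) _ (hg η))) (Subtype.ext_iff.1 hηθ)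
  have h2 := (h.sameOrbit (hg η) (hg θ) h1).component_eq
  rw [hfη, hfη] at h2
  exact Subtype.ext h2

/-- `s` can be mapped to `t` by an embedding of the orbit of `s` into the orbit of `t`. -/
def Compat (α β : SymInv X) (s t : X) : Prop :=
  (∀ n, CanAdvance α n s ↔ CanAdvance β n t) ∧ (∀ n, CanRetreat α n s → CanRetreat β n t) ∧
    ∀ n, s ∈ (α ^ n) s ↔ t ∈ (β ^ n) t

/-- `a` and `b` have the same position relative to `s` and `t`. -/
def Follows (α β : SymInv X) (s t a b : X) : Prop :=
  ∃ n, (a ∈ (α ^ n) s ∧ b ∈ (β ^ n) t) ∨ (s ∈ (α ^ n) a ∧ t ∈ (β ^ n) b)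

theorem Follows.symm (h : Follows α β s t a b) : Follows β α t s b a := by
  obtain ⟨n, h | h⟩ := h
  · exact ⟨n, .inl h.symm⟩
  · exact ⟨n, .inr h.symm⟩

theorem Follows.sameOrbit (h : Follows α β s t a b) : SameOrbit α s a := by
  obtain ⟨n, h | h⟩ := h
  · exact sameOrbit_of_mem h.1
  · exact (sameOrbit_of_mem h.1).symm

/-- Two descriptions of the position of `a` relative to `s` differ by a period of `s`, which is also
a period of `t` and so leads to the same point. -/
theorem Follows.unique (hst : ∀ n, s ∈ (α ^ n) s → t ∈ (β ^ n) t)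
    (hb : Follows α β s t a b) (hc : Follows α β s t a c) : b = c := by
  have fwd : ∀ {m n b c}, m ≤ n → a ∈ (α ^ m) s → b ∈ (β ^ m) t → a ∈ (α ^ n) s →
      c ∈ (β ^ n) t → b = c := by
    intro m n b c hmn h₁ h₂ h₃ h₄
    have h := hst _ (pow_sub_right hmn h₁ h₃)
    have h' := pow_trans h h₂
    rw [Nat.sub_add_cancel hmn] at h'
    exact right_unique h' h₄
  have bwd : ∀ {m n b c}, m ≤ n → s ∈ (α ^ m) a → t ∈ (β ^ m) b → s ∈ (α ^ n) a →
      t ∈ (β ^ n) c → b = c := by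
    intro m n b c hmn h₁ h₂ h₃ h₄
    have h := hst _ (pow_sub_left hmn h₁ h₃)
    have h' := pow_trans h₂ h
    rw [Nat.add_sub_cancel' hmn] at h'
    exact left_unique h' h₄
  have mix : ∀ {m n b c}, a ∈ (α ^ m) s → b ∈ (β ^ m) t → s ∈ (α ^ n) a →
      t ∈ (β ^ n) c → b = c := by
    intro m n b c h₁ h₂ h₃ h₄
    have h := hst _ (pow_trans h₁ h₃)
    exact left_unique (pow_cancel_left h₂ h) h₄
  obtain ⟨m, hb | hb⟩ := hb <;> obtain ⟨n, hc | hc⟩ := hc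
  · rcases le_total m n with h | h
    · exact fwd h hb.1 hb.2 hc.1 hc.2
    · exact (fwd h hc.1 hc.2 hb.1 hb.2).symm
  · exact mix hb.1 hb.2 hc.1 hc.2
  · exact (mix hc.1 hc.2 hb.1 hb.2).symm
  · rcases le_total m n with h | h
    · exact bwd h hb.1 hb.2 hc.1 hc.2
    · exact (bwd h hc.1 hc.2 hb.1 hb.2).symm

theorem Compat.exists_follows (h : Compat α β s t) (ha : SameOrbit α s a) :
    ∃ b, Follows α β s t a b := by
  obtain ⟨n, hn | hn⟩ := ha.exists_pow
  · obtain ⟨b, hb⟩ := (h.1 n).1 ⟨a, hn⟩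
    exact ⟨b, n, .inl ⟨hn, hb⟩⟩
  · obtain ⟨b, hb⟩ := h.2.1 n ⟨a, hn⟩
    exact ⟨b, n, .inr ⟨hn, hb⟩⟩

theorem Compat.follows_right (h : Compat α β s t) (hc : c ∈ α a) (hd : Follows α β s t c d) :
    ∃ b, Follows α β s t a b ∧ d ∈ β b := by
  have bwd : ∀ n, s ∈ (α ^ n) c → t ∈ (β ^ n) d → ∃ b, Follows α β s t a b ∧ d ∈ β b := by
    intro n h₁ h₂
    have h₃ := mem_pow_succ'.2 ⟨c, hc, h₁⟩
    obtain ⟨b, hb⟩ := h.2.1 _ ⟨a, h₃⟩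
    refine ⟨b, ⟨n + 1, .inr ⟨h₃, hb⟩⟩, ?_⟩
    obtain ⟨d', hd', hb'⟩ := mem_pow_succ'.1 hb
    rwa [left_unique h₂ hb']
  obtain ⟨n, hn | hn⟩ := hd
  · rcases n with _ | n
    · exact bwd 0 (mem_pow_zero.2 (mem_pow_zero.1 hn.1).symm)
        (mem_pow_zero.2 (mem_pow_zero.1 hn.2).symm)
    · obtain ⟨a', ha', hc'⟩ := mem_pow_succ.1 hn.1
      obtain ⟨b, hb, hd⟩ := mem_pow_succ.1 hn.2
      obtain rfl := left_unique hc hc'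
      exact ⟨b, ⟨n, .inl ⟨ha', hb⟩⟩, hd⟩
  · exact bwd n hn.1 hn.2

/-- This direction needs advancing from `t` to imply advancing from `s`: last points must not be
sent to points that have a successor. -/
theorem Compat.follows_left (h : Compat α β s t) (hd : d ∈ β b) (hb : Follows α β s t a b) :
    ∃ c, c ∈ α a ∧ Follows α β s t c d := by
  have fwd : ∀ n, a ∈ (α ^ n) s → b ∈ (β ^ n) t → ∃ c, c ∈ α a ∧ Follows α β s t c d := by
    intro n h₁ h₂
    have h₃ := mem_pow_succ.2 ⟨b, h₂, hd⟩
    obtain ⟨c, hc⟩ := (h.1 _).2 ⟨d, h₃⟩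
    refine ⟨c, ?_, n + 1, .inl ⟨hc, h₃⟩⟩
    obtain ⟨a', ha', hc'⟩ := mem_pow_succ.1 hc
    rwa [right_unique h₁ ha']
  obtain ⟨n, hn | hn⟩ := hb
  · exact fwd n hn.1 hn.2
  · rcases n with _ | n
    · exact fwd 0 (mem_pow_zero.2 (mem_pow_zero.1 hn.1).symm)
        (mem_pow_zero.2 (mem_pow_zero.1 hn.2).symm)
    · obtain ⟨c, hc, hc'⟩ := mem_pow_succ'.1 hn.1
      obtain ⟨d', hd', ht⟩ := mem_pow_succ'.1 hn.2
      obtain rfl := right_unique hd hd'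
      exact ⟨c, hc, n, .inr ⟨hc', ht⟩⟩

theorem exists_mem_iff_of_unique (R : X → X → Prop) (h : ∀ a b c, R a b → R a c → b = c)
    (h' : ∀ a b c, R a c → R b c → a = b) : ∃ γ : SymInv X, ∀ a b, b ∈ γ a ↔ R a b := by
  classical
  have key : ∀ (R : X → X → Prop), (∀ a b c, R a b → R a c → b = c) → ∀ a b,
      b ∈ (if h : ∃ b, R a b then some h.choose else none) ↔ R a b := by
    intro R hR a b
    by_cases hb : ∃ b, R a b
    · rw [dif_pos hb, Option.mem_some_iff]
      exact ⟨fun h => h ▸ hb.choose_spec, fun h => hR _ _ _ hb.choose_spec h⟩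
    · rw [dif_neg hb]
      exact iff_of_false (by simp) fun h => hb ⟨b, h⟩
  refine ⟨⟨fun a => if h : ∃ b, R a b then some h.choose else none,
    fun b => if h : ∃ a, R a b then some h.choose else none, fun a b => ?_⟩, key R h⟩
  exact (key (fun b a => R a b) (fun a b c => h' b c a) b a).trans (key R h a b).symm

/-- An injection of components along which compatible base points can be chosen yields an
embedding. -/
theorem exists_intertwines (f : SymInv X → SymInv X)
    (hf : Set.InjOn f (component α '' α.span))
    (h : ∀ η ∈ component α '' α.span, ∃ s t, s ∈ α.span ∧ t ∈ β.span ∧ component α s = η ∧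
      component β t = f η ∧ Compat α β s t) : ∃ γ, Intertwines α β γ := by
  choose s t hs ht hsη htη hst using fun η : component α '' α.span => h η η.2
  -- The union of the position-matching relations is single-valued because `a` determines its orbit
  -- and hence `η`; it is injective because `b` determines `f η` and `f` is injective.
  let R : X → X → Prop := fun a b => ∃ η, Follows α β (s η) (t η) a b
  have hR : ∀ a b c, R a b → R a c → b = c := by
    rintro a b c ⟨η, hb⟩ ⟨θ, hc⟩
    have h1 := (hb.sameOrbit.trans hc.sameOrbit.symm).component_eq
    rw [hsη η, hsη θ] at h1
    obtain rfl := Subtype.ext h1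
    exact hb.unique (fun n => ((hst η).2.2 n).1) hc
  have hR' : ∀ a b c, R a c → R b c → a = b := by
    rintro a b c ⟨η, ha⟩ ⟨θ, hb⟩
    have h1 := (ha.symm.sameOrbit.trans hb.symm.sameOrbit.symm).component_eq
    rw [htη η, htη θ] at h1
    obtain rfl := Subtype.ext (hf η.2 θ.2 h1)
    exact ha.symm.unique (fun n => ((hst η).2.2 n).2) hb.symm
  obtain ⟨γ, hγ⟩ := exists_mem_iff_of_unique R hR hR'
  refine ⟨γ, fun a ha => ?_, ext_mem fun a d => ?_⟩
  · let η : component α '' α.span := ⟨component α a, a, .inr ha, rfl⟩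
    obtain ⟨b, hb⟩ := (hst η).exists_follows (sameOrbit_of_component_eq (hs η) (hsη η))
    exact ⟨b, (hγ a b).2 ⟨η, hb⟩⟩
  · simp only [mem_mul, hγ]
    constructor
    · rintro ⟨c, hc, η, hd⟩
      obtain ⟨b, hb, hd⟩ := (hst η).follows_right hc hd
      exact ⟨b, ⟨η, hb⟩, hd⟩
    · rintro ⟨b, ⟨η, hb⟩, hd⟩
      obtain ⟨c, hc, hd⟩ := (hst η).follows_left hd hb
      exact ⟨c, hc, η, hd⟩

end Embedding

end SymInv

/-! ### Injections respecting a relation -/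

section Matching

variable {M : Type*} {P : M → M → Prop} {A B A' B' : Set M}

/-- There is an injection `f` from `A` to `B` such that `P a (f a)` for all `a ∈ A`. -/
def HasMatching (P : M → M → Prop) (A B : Set M) : Prop :=
  ∃ f : M → M, Set.InjOn f A ∧ ∀ a ∈ A, f a ∈ B ∧ P a (f a)

theorem HasMatching.mono (h : HasMatching P A B) (hB : B ⊆ B') : HasMatching P A B' := by
  obtain ⟨f, hf, hfP⟩ := h
  exact ⟨f, hf, fun a ha => ⟨hB (hfP a ha).1, (hfP a ha).2⟩⟩

theorem hasMatching_empty : HasMatching P ∅ B :=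
  ⟨id, by simp, by simp⟩

theorem HasMatching.iUnion {ι : Type*} {A B : ι → Set M} (h : ∀ i, HasMatching P (A i) (B i))
    (hB : Pairwise fun i j => Disjoint (B i) (B j)) : HasMatching P (⋃ i, A i) (⋃ i, B i) := by
  classical
  choose f hf hfP using h
  -- The sets `A i` may overlap, so an index is chosen for each element; `none` serves the elements
  -- outside the union.
  have key : ∀ a, ∃ i : Option ι, a ∈ ⋃ i, A i → ∃ j, i = some j ∧ a ∈ A j := by
    intro a
    by_cases ha : a ∈ ⋃ i, A i
    · obtain ⟨i, hi⟩ := Set.mem_iUnion.1 ha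
      exact ⟨some i, fun _ => ⟨i, rfl, hi⟩⟩
    · exact ⟨none, fun h => absurd h ha⟩
  choose i hi using key
  refine ⟨fun a => (i a).elim a fun j => f j a, fun a ha b hb hab => ?_, fun a ha => ?_⟩
  · obtain ⟨j, hj, haj⟩ := hi a ha
    obtain ⟨k, hk, hbk⟩ := hi b hb
    simp only [hj, hk, Option.elim_some] at hab
    by_cases hjk : j = k
    · subst hjk
      exact hf j haj hbk hab
    · exact absurd hab (Set.disjoint_iff_forall_ne.1 (hB hjk) (hfP j a haj).1 (hfP k b hbk).1)
  · obtain ⟨j, hj, haj⟩ := hi a ha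
    simp only [hj, Option.elim_some]
    exact ⟨Set.mem_iUnion.2 ⟨j, (hfP j a haj).1⟩, (hfP j a haj).2⟩

theorem HasMatching.union (h : HasMatching P A B) (h' : HasMatching P A' B')
    (hB : Disjoint B B') : HasMatching P (A ∪ A') (B ∪ B') := by
  rw [Set.union_eq_iUnion, Set.union_eq_iUnion]
  refine HasMatching.iUnion (fun b => by cases b <;> assumption) fun b c hbc => ?_
  cases b <;> cases c
  · exact absurd rfl hbc
  · exact hB.symm
  · exact hB
  · exact absurd rfl hbc

theorem hasMatching_of_mk_eq (h : #A = #B) (hP : ∀ a ∈ A, ∀ b ∈ B, P a b) :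
    HasMatching P A B := by
  classical
  obtain ⟨e⟩ := Cardinal.eq.1 h
  refine ⟨fun a => if ha : a ∈ A then e ⟨a, ha⟩ else a, fun a ha b hb hab => ?_, fun a ha => ?_⟩
  · simp only [ha, hb, dif_pos] at hab
    exact Subtype.ext_iff.1 (e.injective (Subtype.ext hab))
  · simp only [ha, dif_pos]
    exact ⟨Subtype.mem _, hP a ha _ (Subtype.mem _)⟩

/-- Greedy choice: `G n` collects the finitely many earlier picks, which the `n`th pick avoids. -/
theorem exists_injective_mem {S : ℕ → Set M} (hS : ∀ n, (S n).Infinite) :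
    ∃ g : ℕ → M, Function.Injective g ∧ ∀ n, g n ∈ S n := by
  classical
  choose pick hpick hpick' using fun n (s : Finset M) => (hS n).exists_notMem_finset s
  let G : ℕ → Finset M := fun n => Nat.rec ∅ (fun n s => insert (pick n s) s) n
  have hG : ∀ n, G (n + 1) = insert (pick n (G n)) (G n) := fun _ => rfl
  have hmono : Monotone G := monotone_nat_of_le_succ fun n => by
    rw [hG]
    exact Finset.subset_insert _ _
  have hne : ∀ m n, m < n → pick m (G m) ≠ pick n (G n) := fun m n hmn h =>
    hpick' n (G n) (h ▸ hmono (Nat.succ_le_of_lt hmn) (by rw [hG]; exact Finset.mem_insert_self _ _))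
  refine ⟨fun n => pick n (G n), fun m n h => ?_, fun n => hpick n _⟩
  rcases lt_trichotomy m n with hmn | hmn | hmn
  · exact absurd h (hne m n hmn)
  · exact hmn
  · exact absurd h.symm (hne n m hmn)

theorem hasMatching_of_infinite (hA : A.Countable)
    (h : ∀ a ∈ A, {b | b ∈ B ∧ P a b}.Infinite) : HasMatching P A B := by
  classical
  rcases A.eq_empty_or_nonempty with rfl | hne
  · exact hasMatching_empty
  obtain ⟨u, hu⟩ := hA.exists_eq_range hne
  have hmem : ∀ n, u n ∈ A := fun n => hu ▸ Set.mem_range_self n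
  obtain ⟨g, hg, hgS⟩ := exists_injective_mem fun n => h (u n) (hmem n)
  have key : ∀ a, ∃ n, a ∈ A → u n = a := fun a => by
    by_cases ha : a ∈ A
    · obtain ⟨n, hn⟩ := hu ▸ ha
      exact ⟨n, fun _ => hn⟩
    · exact ⟨0, fun h => absurd h ha⟩
  choose n hn using key
  refine ⟨fun a => g (n a), fun a ha b hb hab => ?_, fun a ha => ?_⟩
  · rw [← hn a ha, ← hn b hb, hg hab]
  · have := hgS (n a)
    rw [hn a ha] at this
    exact this

end Matching

namespace SymInv

/-! ### Counting components, and the invariants `k_α` and `m_α` -/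

section Chains

variable {X : Type*} {α β γ η θ : SymInv X} {a b c d s t : X} {m n j k : ℕ}

theorem disjoint_image_component {S T : Set X} (hS : S ⊆ α.span)
    (h : ∀ a ∈ S, ∀ b ∈ T, ¬ SameOrbit α a b) :
    Disjoint (component α '' S) (component α '' T) := by
  rw [Set.disjoint_iff_forall_ne]
  rintro _ ⟨a, ha, rfl⟩ _ ⟨b, hb, rfl⟩ hab
  exact h a ha b hb (sameOrbit_of_component_eq (hS ha) hab)

theorem SameOrbit.eq_of_last (h : SameOrbit α a b) (ha : ¬ CanAdvance α 1 a)
    (hb : ¬ CanAdvance α 1 b) : a = b := by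
  obtain ⟨m, n, c, h₁, h₂⟩ := h
  obtain rfl := eq_zero_of_not_canAdvance ha ⟨c, h₁⟩
  obtain rfl := eq_zero_of_not_canAdvance hb ⟨c, h₂⟩
  rw [mem_pow_zero.1 h₁, mem_pow_zero.1 h₂]

theorem disjoint_chains (hj : 1 ≤ j) (hk : 1 ≤ k) (hjk : j ≠ k) :
    Disjoint (chains α j) (chains α k) := by
  rw [chains_eq hj, chains_eq hk]
  refine disjoint_image_component (fun a => mem_span_of_chainEnds hj) fun a ha b hb hab => ?_
  obtain rfl := hab.eq_of_last ha.1 hb.1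
  rcases lt_or_gt_of_ne hjk with h | h
  · exact ha.2.2 (hb.2.1.mono h)
  · exact hb.2.2 (ha.2.1.mono h)

theorem disjoint_leftRays_chains (hk : 1 ≤ k) : Disjoint (leftRays α) (chains α k) := by
  rw [leftRays_eq, chains_eq hk]
  refine disjoint_image_component (fun a => mem_span_of_leftEnds) fun a ha b hb hab => ?_
  obtain rfl := hab.eq_of_last ha.1 hb.1
  exact hb.2.2 (ha.2 _)

/-- The chains of length at least `k` contained in `α`. -/
def chainsFrom (α : SymInv X) (k : ℕ) : Set (SymInv X) := ⋃ i, chains α (k + i)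

theorem mem_chainsFrom : θ ∈ chainsFrom α k ↔ ∃ j, k ≤ j ∧ θ ∈ chains α j := by
  rw [chainsFrom, Set.mem_iUnion]
  constructor
  · rintro ⟨i, hi⟩
    exact ⟨_, Nat.le_add_right k i, hi⟩
  · rintro ⟨j, hj, h⟩
    obtain ⟨i, rfl⟩ := Nat.exists_eq_add_of_le hj
    exact ⟨i, h⟩

theorem chainsFrom_anti (h : j ≤ k) : chainsFrom α k ⊆ chainsFrom α j := fun θ hθ => by
  obtain ⟨i, hi, hθ⟩ := mem_chainsFrom.1 hθ
  exact mem_chainsFrom.2 ⟨i, h.trans hi, hθ⟩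

theorem chains_subset_chainsFrom (h : j ≤ k) : chains α k ⊆ chainsFrom α j := fun _ hθ =>
  mem_chainsFrom.2 ⟨k, h, hθ⟩

theorem chainsFrom_eq_union : chainsFrom α k = chains α k ∪ chainsFrom α (k + 1) := by
  ext θ
  simp only [Set.mem_union, mem_chainsFrom]
  constructor
  · rintro ⟨j, hj, h⟩
    rcases hj.eq_or_lt with rfl | hj
    · exact .inl h
    · exact .inr ⟨j, hj, h⟩
  · rintro (h | ⟨j, hj, h⟩)
    · exact ⟨k, le_rfl, h⟩
    · exact ⟨j, by omega, h⟩

theorem disjoint_leftRays_chainsFrom (hk : 1 ≤ k) :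
    Disjoint (leftRays α) (chainsFrom α k) :=
  Set.disjoint_iUnion_right.2 fun _ => disjoint_leftRays_chains (by omega)

theorem disjoint_chains_chainsFrom (hj : 1 ≤ j) (hjk : j < k) :
    Disjoint (chains α j) (chainsFrom α k) :=
  Set.disjoint_iUnion_right.2 fun _ => disjoint_chains hj (by omega) (by omega)

theorem mk_chainsFrom (hk : 1 ≤ k) :
    #(chainsFrom α k) = #(chains α k) + #(chainsFrom α (k + 1)) := by
  rw [chainsFrom_eq_union,
    mk_union_of_disjoint (disjoint_chains_chainsFrom hk (Nat.lt_succ_self k))]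

/-- The last points of chains and left rays which have at least `k` predecessors. -/
def lastPoints (α : SymInv X) (k : ℕ) : Set X := {a | ¬ CanAdvance α 1 a ∧ CanRetreat α k a}

theorem mem_span_of_lastPoints (hk : 1 ≤ k) (h : a ∈ lastPoints α k) : a ∈ α.span :=
  .inr (canRetreat_one.1 (h.2.mono hk))

/-- Intertwiners preserve being a last point with `k` predecessors, but a chain may land in a left
ray; hence only the union can be compared. -/
theorem image_lastPoints (hk : 1 ≤ k) :
    component α '' lastPoints α k = leftRays α ∪ chainsFrom α k := by
  refine Set.Subset.antisymm ?_ (Set.union_subset ?_ ?_)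
  · rintro _ ⟨a, ha, rfl⟩
    by_cases h : ∀ n, CanRetreat α n a
    · rw [leftRays_eq]
      exact .inl ⟨a, ⟨ha.1, h⟩, rfl⟩
    · obtain ⟨j, hj, haj⟩ := mem_chainEnds_of_last (mem_span_of_lastPoints hk ha) ha.1 h
      refine .inr (mem_chainsFrom.2 ⟨j, ?_, chains_eq hj ▸ ⟨a, haj, rfl⟩⟩)
      by_contra hkj
      exact haj.2.2 (ha.2.mono (by omega))
  · rw [leftRays_eq]
    rintro _ ⟨a, ha, rfl⟩
    exact ⟨a, ⟨ha.1, ha.2 k⟩, rfl⟩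
  · rintro θ hθ
    obtain ⟨j, hj, hθ⟩ := mem_chainsFrom.1 hθ
    rw [chains_eq (hk.trans hj)] at hθ
    obtain ⟨a, ha, rfl⟩ := hθ
    exact ⟨a, ⟨ha.1, ha.2.1.mono hj⟩, rfl⟩

theorem disjoint_rightRays_doubleRays : Disjoint (rightRays α) (doubleRays α) := by
  rw [rightRays_eq, doubleRays_eq]
  refine disjoint_image_component (fun a => mem_span_of_rightStarts) fun a ha b hb hab => ?_
  exact ha.1 (hab.symm.canRetreat hb.2.1 1)

/-- The non-periodic points all of whose forward iterates are defined. -/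
def advancingPoints (α : SymInv X) : Set X :=
  {a | (∀ n, CanAdvance α n a) ∧ ∀ n, a ∈ (α ^ n) a → n = 0}

theorem mem_span_of_advancingPoints (h : a ∈ advancingPoints α) : a ∈ α.span :=
  .inl (canAdvance_one.1 (h.1 1))

theorem mem_advancingPoints_of_rightStarts (h : a ∈ rightStarts α) : a ∈ advancingPoints α :=
  ⟨h.2, fun _ hn => eq_zero_of_not_canRetreat h.1 ⟨a, hn⟩⟩

/-- Likewise a right ray may land in a double ray, so the two types are counted together. -/
theorem image_advancingPoints :
    component α '' advancingPoints α = rightRays α ∪ doubleRays α := by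
  rw [rightRays_eq, doubleRays_eq, ← Set.image_union]
  refine Set.Subset.antisymm ?_ (Set.image_mono (Set.union_subset
    (fun _ => mem_advancingPoints_of_rightStarts) fun a ha => ⟨ha.1, ha.2.2⟩))
  rintro _ ⟨a, ha, rfl⟩
  by_cases h : ∀ n, CanRetreat α n a
  · exact ⟨a, .inr ⟨ha.1, h, ha.2⟩, rfl⟩
  · obtain ⟨b, hb, hb'⟩ := exists_first h
    exact ⟨b, .inl ⟨hb', hb.canAdvance ha.1⟩, hb.component_eq.symm⟩

theorem Intertwines.mk_cycles_le (h : Intertwines α β γ) (k : ℕ) :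
    #(cycles α k) ≤ #(cycles β k) := by
  rw [cycles_eq, cycles_eq]
  refine h.mk_image_le (fun _ => mem_span_of_cyclePoints) (fun _ => mem_span_of_cyclePoints)
    fun a ha c hc => ⟨ha.1, (h.mem_pow_self_iff hc).2 ha.2.1, fun n hn hcn => ?_⟩
  exact ha.2.2 n hn ((h.mem_pow_self_iff hc).1 hcn)

theorem Intertwines.mk_doubleRays_le (h : Intertwines α β γ) :
    #(doubleRays α) ≤ #(doubleRays β) := by
  rw [doubleRays_eq, doubleRays_eq]
  refine h.mk_image_le (fun _ => mem_span_of_doublePoints) (fun _ => mem_span_of_doublePoints)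
    fun a ha c hc => ⟨fun n => (h.canAdvance_iff hc).2 (ha.1 n), fun n => ?_,
      fun n hcn => ha.2.2 n ((h.mem_pow_self_iff hc).1 hcn)⟩
  -- Retreating `n + 1` steps avoids the excluded exponent `0`.
  exact (h.canRetreat hc n.succ_ne_zero (ha.2.1 (n + 1))).mono n.le_succ

theorem Intertwines.mk_leftRays_le (h : Intertwines α β γ) :
    #(leftRays α) ≤ #(leftRays β) := by
  rw [leftRays_eq, leftRays_eq]
  refine h.mk_image_le (fun _ => mem_span_of_leftEnds) (fun _ => mem_span_of_leftEnds)
    fun a ha c hc => ⟨mt (h.canAdvance_iff hc).1 ha.1, fun n => ?_⟩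
  exact (h.canRetreat hc n.succ_ne_zero (ha.2 (n + 1))).mono n.le_succ

theorem Intertwines.mk_rightRays_add_doubleRays_le (h : Intertwines α β γ) :
    #(rightRays α) + #(doubleRays α) ≤ #(rightRays β) + #(doubleRays β) := by
  rw [← mk_union_of_disjoint disjoint_rightRays_doubleRays,
    ← mk_union_of_disjoint disjoint_rightRays_doubleRays, ← image_advancingPoints,
    ← image_advancingPoints]
  exact h.mk_image_le (fun _ => mem_span_of_advancingPoints)
    (fun _ => mem_span_of_advancingPoints)
    fun a ha c hc => ⟨fun n => (h.canAdvance_iff hc).2 (ha.1 n),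
      fun n hcn => ha.2 n ((h.mem_pow_self_iff hc).1 hcn)⟩

theorem Intertwines.mk_leftRays_add_chainsFrom_le (h : Intertwines α β γ) (hk : 1 ≤ k) :
    #(leftRays α) + #(chainsFrom α k) ≤ #(leftRays β) + #(chainsFrom β k) := by
  rw [← mk_union_of_disjoint (disjoint_leftRays_chainsFrom hk),
    ← mk_union_of_disjoint (disjoint_leftRays_chainsFrom hk), ← image_lastPoints hk,
    ← image_lastPoints hk]
  exact h.mk_image_le (fun _ => mem_span_of_lastPoints hk) (fun _ => mem_span_of_lastPoints hk)
    fun a ha c hc => ⟨mt (h.canAdvance_iff hc).1 ha.1, h.canRetreat hc (by omega) ha.2⟩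

/-- Expresses the supremum through the sets `chainsFrom`, whose cardinalities are what intertwiners
control. -/
theorem natCast_le_maxChain (hk : 1 ≤ k) :
    (k : ℕ∞) ≤ maxChain α ↔ (chainsFrom α k).Nonempty := by
  constructor
  · intro h
    by_contra hne
    have hle : maxChain α ≤ ((k - 1 : ℕ) : ℕ∞) := by
      refine iSup₂_le fun j ⟨_, θ, hθ⟩ => ?_
      have : ¬ k ≤ j := fun hkj => hne ⟨θ, mem_chainsFrom.2 ⟨j, hkj, hθ⟩⟩
      exact_mod_cast (by omega : j ≤ k - 1)
    have := h.trans hle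
    have : k ≤ k - 1 := by exact_mod_cast this
    omega
  · rintro ⟨θ, hθ⟩
    obtain ⟨j, hj, hθ⟩ := mem_chainsFrom.1 hθ
    exact le_trans (by exact_mod_cast hj)
      (le_iSup₂ (f := fun (k : ℕ) (_ : k ∈ {k : ℕ | 1 ≤ k ∧ (chains α k).Nonempty}) => (k : ℕ∞))
        j ⟨hk.trans hj, θ, hθ⟩)

theorem maxChain_congr (h : ∀ k, 1 ≤ k → #(chainsFrom α k) = #(chainsFrom β k)) :
    maxChain α = maxChain β := by
  have key : ∀ k : ℕ, (k : ℕ∞) ≤ maxChain α ↔ (k : ℕ∞) ≤ maxChain β := by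
    intro k
    rcases k.eq_zero_or_pos with rfl | hk
    · simp
    · rw [natCast_le_maxChain hk, natCast_le_maxChain hk, ← Set.nonempty_coe_sort,
        ← Set.nonempty_coe_sort, ← mk_ne_zero_iff, ← mk_ne_zero_iff, h k hk]
  exact ENat.eq_of_forall_natCast_le_iff key

theorem bddAbove_infinite_chains {K : ℕ} (hK : maxChain α = K) :
    BddAbove {m : ℕ | 1 ≤ m ∧ (m : ℕ∞) ≤ maxChain α ∧ #(chains α m) = ℵ₀} :=
  ⟨K, fun m hm => by exact_mod_cast hK ▸ hm.2.1⟩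

variable [Countable X]

theorem countable_chains (hk : 1 ≤ k) : (chains α k).Countable := by
  rw [chains_eq hk]
  exact (Set.to_countable _).image _

/-- Only the finitely many lengths up to `K` occur, so the chains of length at least `k` are finite
in number exactly when each length contributes finitely many. -/
theorem maxInfChain_lt_iff {K : ℕ} (hK : maxChain α = K) (hk : 1 ≤ k) :
    maxInfChain α < k ↔ (chainsFrom α k).Finite := by
  constructor
  · intro h
    have : chainsFrom α k ⊆ ⋃ j ∈ Set.Icc k K, chains α j := by
      intro θ hθ
      obtain ⟨j, hj, hθ⟩ := mem_chainsFrom.1 hθ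
      have hjK : (j : ℕ∞) ≤ maxChain α :=
        (natCast_le_maxChain (hk.trans hj)).2 ⟨θ, mem_chainsFrom.2 ⟨j, le_rfl, hθ⟩⟩
      rw [hK] at hjK
      exact Set.mem_biUnion (Set.mem_Icc.2 ⟨hj, by exact_mod_cast hjK⟩) hθ
    refine Set.Finite.subset ((Set.finite_Icc k K).biUnion fun j hj => ?_) this
    by_contra hinf
    have hj1 := hk.trans hj.1
    have hc : #(chains α j) = ℵ₀ :=
      le_antisymm (le_aleph0_iff_set_countable.2 (countable_chains hj1))
        (not_lt.1 fun hlt => hinf (lt_aleph0_iff_set_finite.1 hlt))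
    have := le_csSup (bddAbove_infinite_chains hK)
      (show j ∈ _ from ⟨hj1, by rw [hK]; exact_mod_cast hj.2, hc⟩)
    exact absurd (h.trans_le hj.1) (not_lt.2 this)
  · intro h
    by_contra hlt
    have hmem : maxInfChain α ∈
        {m : ℕ | 1 ≤ m ∧ (m : ℕ∞) ≤ maxChain α ∧ #(chains α m) = ℵ₀} := by
      refine Nat.sSup_mem ?_ (bddAbove_infinite_chains hK)
      by_contra hne
      rw [Set.not_nonempty_iff_eq_empty] at hne
      -- The default supremum `0` of the empty set is below `k`, contrary to `hlt`.
      have : maxInfChain α = 0 := by rw [maxInfChain, hne, csSup_empty]; rfl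
      omega
    have hfin := h.subset (chains_subset_chainsFrom (α := α) (not_lt.1 hlt))
    exact (lt_aleph0_iff_set_finite.2 hfin).ne hmem.2.2

theorem maxInfChain_congr {K : ℕ} (hK : maxChain α = K)
    (h : ∀ k, 1 ≤ k → #(chainsFrom α k) = #(chainsFrom β k)) :
    maxInfChain α = maxInfChain β := by
  have hK' := (maxChain_congr h).symm.trans hK
  have key : ∀ k, maxInfChain α < k ↔ maxInfChain β < k := by
    intro k
    rcases k.eq_zero_or_pos with rfl | hk
    · simp
    · rw [maxInfChain_lt_iff hK hk, maxInfChain_lt_iff hK' hk, ← lt_aleph0_iff_set_finite,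
        ← lt_aleph0_iff_set_finite, h k hk]
  have h1 := (key (maxInfChain β + 1)).2 (Nat.lt_succ_self _)
  have h2 := (key (maxInfChain α + 1)).1 (Nat.lt_succ_self _)
  omega

/-- Beyond `m_α` the chains longer than `k` are finite in number, so they cancel from the count of
chains of length at least `k`. -/
theorem mk_chains_congr {K : ℕ} (hK : maxChain α = K)
    (h : ∀ k, 1 ≤ k → #(chainsFrom α k) = #(chainsFrom β k)) (hk : maxInfChain α + 1 ≤ k) :
    #(chains α k) = #(chains β k) := by
  have h1 := h k (by omega)
  rw [mk_chainsFrom (α := α) (by omega), mk_chainsFrom (α := β) (by omega), ← h (k + 1) (by omega)] at h1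
  exact Cardinal.eq_of_add_eq_add_right h1 (lt_aleph0_iff_set_finite.2
    ((maxInfChain_lt_iff hK (by omega)).1 (by omega)))

end Chains

/-! ### Compatible components and construction of the matching -/

section Assembly

variable {X : Type*} {α β η θ : SymInv X} {a b c d s t : X} {m n j k : ℕ}

/-- The components `η` of `α` and `θ` of `β` have compatible base points. -/
def CompatComponents (α β : SymInv X) (η θ : SymInv X) : Prop :=
  ∃ s t, s ∈ α.span ∧ t ∈ β.span ∧ component α s = η ∧ component β t = θ ∧ Compat α β s t

/-- At last points the advancing and period conditions hold only for `n = 0`, which leaves the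
backward condition. -/
theorem compat_of_last (hs : ¬ CanAdvance α 1 s) (ht : ¬ CanAdvance β 1 t)
    (h : ∀ n, CanRetreat α n s → CanRetreat β n t) : Compat α β s t := by
  have key : ∀ {α : SymInv X} {s n}, ¬ CanAdvance α 1 s → (CanAdvance α n s ↔ n = 0) :=
    fun h => ⟨eq_zero_of_not_canAdvance h, fun h0 => h0 ▸ canAdvance_zero⟩
  have key' : ∀ {α : SymInv X} {s n}, ¬ CanAdvance α 1 s → (s ∈ (α ^ n) s ↔ n = 0) :=
    fun h => ⟨fun hn => eq_zero_of_not_canAdvance h ⟨_, hn⟩, fun h0 => h0 ▸ mem_pow_zero.2 rfl⟩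
  exact ⟨fun n => (key hs).trans (key ht).symm, h, fun n => (key' hs).trans (key' ht).symm⟩

theorem compat_of_advancing (hs : s ∈ advancingPoints α) (ht : t ∈ advancingPoints β)
    (h : ∀ n, CanRetreat α n s → CanRetreat β n t) : Compat α β s t :=
  ⟨fun n => iff_of_true (hs.1 n) (ht.1 n), h, fun n =>
    ⟨fun hn => hs.2 n hn ▸ mem_pow_zero.2 rfl, fun hn => ht.2 n hn ▸ mem_pow_zero.2 rfl⟩⟩

theorem mem_advancingPoints_of_doublePoints (h : a ∈ doublePoints α) : a ∈ advancingPoints α :=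
  ⟨h.1, h.2.2⟩

theorem pow_mul_of_cyclePoints (h : a ∈ cyclePoints α k) (q : ℕ) : a ∈ (α ^ (k * q)) a := by
  induction q with
  | zero => exact mem_pow_zero.2 rfl
  | succ q ih => exact pow_trans ih h.2.1

theorem mem_pow_iff_of_cyclePoints (h : a ∈ cyclePoints α k) : a ∈ (α ^ n) a ↔ k ∣ n := by
  constructor
  · intro hn
    rw [← Nat.div_add_mod n k] at hn
    exact Nat.dvd_of_mod_eq_zero (h.2.2 _ (Nat.mod_lt n h.1)
      (pow_cancel_left (pow_mul_of_cyclePoints h _) hn))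
  · rintro ⟨q, rfl⟩
    exact pow_mul_of_cyclePoints h q

theorem canAdvance_of_cyclePoints (h : a ∈ cyclePoints α k) (n : ℕ) : CanAdvance α n a :=
  CanAdvance.mono (Nat.le_mul_of_pos_left n h.1) ⟨a, pow_mul_of_cyclePoints h n⟩

theorem canRetreat_of_cyclePoints (h : a ∈ cyclePoints α k) (n : ℕ) : CanRetreat α n a :=
  CanRetreat.mono (Nat.le_mul_of_pos_left n h.1) ⟨a, pow_mul_of_cyclePoints h n⟩

theorem compatComponents_cycles (hη : η ∈ cycles α k) (hθ : θ ∈ cycles β k) :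
    CompatComponents α β η θ := by
  rw [cycles_eq] at hη hθ
  obtain ⟨s, hs, rfl⟩ := hη
  obtain ⟨t, ht, rfl⟩ := hθ
  exact ⟨s, t, mem_span_of_cyclePoints hs, mem_span_of_cyclePoints ht, rfl, rfl,
    fun n => iff_of_true (canAdvance_of_cyclePoints hs n) (canAdvance_of_cyclePoints ht n),
    fun n _ => canRetreat_of_cyclePoints ht n,
    fun n => (mem_pow_iff_of_cyclePoints hs).trans (mem_pow_iff_of_cyclePoints ht).symm⟩

theorem compatComponents_doubleRays (hη : η ∈ rightRays α ∪ doubleRays α)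
    (hθ : θ ∈ doubleRays β) : CompatComponents α β η θ := by
  rw [← image_advancingPoints] at hη
  rw [doubleRays_eq] at hθ
  obtain ⟨s, hs, rfl⟩ := hη
  obtain ⟨t, ht, rfl⟩ := hθ
  exact ⟨s, t, mem_span_of_advancingPoints hs, mem_span_of_doublePoints ht, rfl, rfl,
    compat_of_advancing hs (mem_advancingPoints_of_doublePoints ht) fun n _ => ht.2.1 n⟩

theorem compatComponents_rightRays (hη : η ∈ rightRays α) (hθ : θ ∈ rightRays β) :
    CompatComponents α β η θ := by
  rw [rightRays_eq] at hη hθ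
  obtain ⟨s, hs, rfl⟩ := hη
  obtain ⟨t, ht, rfl⟩ := hθ
  refine ⟨s, t, mem_span_of_rightStarts hs, mem_span_of_rightStarts ht, rfl, rfl,
    compat_of_advancing (mem_advancingPoints_of_rightStarts hs)
      (mem_advancingPoints_of_rightStarts ht) fun n hn => ?_⟩
  rw [eq_zero_of_not_canRetreat hs.1 hn]
  exact canRetreat_zero

theorem compatComponents_leftRays (hη : η ∈ leftRays α ∪ chainsFrom α 1)
    (hθ : θ ∈ leftRays β) : CompatComponents α β η θ := by
  rw [← image_lastPoints le_rfl] at hη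
  rw [leftRays_eq] at hθ
  obtain ⟨s, hs, rfl⟩ := hη
  obtain ⟨t, ht, rfl⟩ := hθ
  exact ⟨s, t, mem_span_of_lastPoints le_rfl hs, mem_span_of_leftEnds ht, rfl, rfl,
    compat_of_last hs.1 ht.1 fun n _ => ht.2 n⟩

/-- The shorter chain is laid along the final segment of the longer one, last point on last point.
-/
theorem compatComponents_chains (hj : 1 ≤ j) (hjk : j ≤ k) (hη : η ∈ chains α j)
    (hθ : θ ∈ chains β k) : CompatComponents α β η θ := by
  rw [chains_eq hj] at hη
  rw [chains_eq (hj.trans hjk)] at hθ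
  obtain ⟨s, hs, rfl⟩ := hη
  obtain ⟨t, ht, rfl⟩ := hθ
  refine ⟨s, t, mem_span_of_chainEnds hj hs, mem_span_of_chainEnds (hj.trans hjk) ht, rfl, rfl,
    compat_of_last hs.1 ht.1 fun n hn => ht.2.1.mono (le_trans ?_ hjk)⟩
  by_contra hlt
  exact hs.2.2 (hn.mono (by omega))

/-- The periods are the multiples of the length and are the same throughout an orbit. -/
theorem disjoint_cycles (hjk : j ≠ k) : Disjoint (cycles α j) (cycles α k) := by
  rw [cycles_eq, cycles_eq]
  refine disjoint_image_component (fun _ => mem_span_of_cyclePoints) fun a ha b hb hab => hjk ?_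
  exact Nat.dvd_antisymm
    ((mem_pow_iff_of_cyclePoints ha).1 (hab.symm.mem_pow_self hb.2.1))
    ((mem_pow_iff_of_cyclePoints hb).1 (hab.mem_pow_self ha.2.1))

theorem disjoint_cycles_advancing :
    Disjoint (⋃ k, cycles α k) (rightRays α ∪ doubleRays α) := by
  rw [← image_advancingPoints]
  simp only [cycles_eq]
  refine Set.disjoint_iUnion_left.2 fun k => disjoint_image_component
    (fun _ => mem_span_of_cyclePoints) fun a ha b hb hab => ?_
  have := hb.2 k (hab.mem_pow_self ha.2.1)
  have := ha.1
  omega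

theorem disjoint_cycles_terminating :
    Disjoint (⋃ k, cycles α k) (leftRays α ∪ chainsFrom α 1) := by
  rw [← image_lastPoints le_rfl]
  simp only [cycles_eq]
  exact Set.disjoint_iUnion_left.2 fun k => disjoint_image_component
    (fun _ => mem_span_of_cyclePoints) fun a ha b hb hab =>
      hb.1 (hab.canAdvance (canAdvance_of_cyclePoints ha) 1)

theorem disjoint_advancing_terminating :
    Disjoint (rightRays α ∪ doubleRays α) (leftRays α ∪ chainsFrom α 1) := by
  rw [← image_lastPoints le_rfl, ← image_advancingPoints]
  exact disjoint_image_component (fun _ => mem_span_of_advancingPoints) fun a ha b hb hab =>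
    hb.1 (hab.canAdvance ha.1 1)

theorem components_subset : component α '' α.span ⊆
    (⋃ k, cycles α k) ∪ ((rightRays α ∪ doubleRays α) ∪ (leftRays α ∪ chainsFrom α 1)) := by
  rintro _ ⟨a, ha, rfl⟩
  obtain ⟨b, hab, h⟩ := exists_basePoint ha
  rw [hab.component_eq]
  rcases h with h | ⟨k, hk, h⟩ | h | h | ⟨k, h⟩
  · exact .inr (.inr (.inl (leftRays_eq ▸ ⟨b, h, rfl⟩)))
  · exact .inr (.inr (.inr (mem_chainsFrom.2 ⟨k, hk, chains_eq hk ▸ ⟨b, h, rfl⟩⟩)))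
  · exact .inr (.inl (.inl (rightRays_eq ▸ ⟨b, h, rfl⟩)))
  · exact .inr (.inl (.inr (doubleRays_eq ▸ ⟨b, h, rfl⟩)))
  · exact .inl (Set.mem_iUnion.2 ⟨k, cycles_eq ▸ ⟨b, h, rfl⟩⟩)

theorem infinite_chainsFrom (h : maxChain α = ⊤) (hk : 1 ≤ k) : (chainsFrom α k).Infinite := by
  let L : Set ℕ := {j | k ≤ j ∧ (chains α j).Nonempty}
  have hL : L.Infinite := Set.infinite_of_forall_exists_gt fun n => by
    obtain ⟨θ, hθ⟩ := (natCast_le_maxChain (α := α) (k := n + k + 1) (by omega)).1 (h ▸ le_top)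
    obtain ⟨j, hj, hθ⟩ := mem_chainsFrom.1 hθ
    exact ⟨j, ⟨by omega, θ, hθ⟩, by omega⟩
  choose! f hf using fun j (hj : j ∈ L) => hj.2
  refine Set.infinite_of_injOn_mapsTo (f := f) (fun i hi j hj hij => ?_)
    (fun j hj => mem_chainsFrom.2 ⟨j, hj.1, hf j hj⟩) hL
  by_contra hne
  exact Set.disjoint_iff_forall_ne.1
    (disjoint_chains (hk.trans hi.1) (hk.trans hj.1) hne) (hf i hi) (hf j hj) hij

theorem mem_chains_le_maxChain (hk : 1 ≤ k) (hθ : θ ∈ chains α k) : (k : ℕ∞) ≤ maxChain α :=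
  (natCast_le_maxChain hk).2 ⟨θ, chains_subset_chainsFrom le_rfl hθ⟩

/-- Equality of the invariants of `α` and `β` which determine the `c`-conjugacy class. -/
def SameInvariants (α β : SymInv X) : Prop :=
  ((∀ k : ℕ, 1 ≤ k → #(α.cycles k) = #(β.cycles k)) ∧
      #α.doubleRays = #β.doubleRays ∧ #α.leftRays = #β.leftRays) ∧
    (α.doubleRays.Finite → #α.rightRays = #β.rightRays) ∧
    (α.leftRays.Finite →
      α.maxChain = β.maxChain ∧
        ∀ K : ℕ, 1 ≤ K → α.maxChain = (K : ℕ∞) →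
          α.maxInfChain = β.maxInfChain ∧
            ∀ k : ℕ, α.maxInfChain + 1 ≤ k → k ≤ K →
              #(α.chains k) = #(β.chains k))

theorem finite_congr {S T : Set (SymInv X)} (h : #S = #T) : S.Finite ↔ T.Finite := by
  rw [← lt_aleph0_iff_set_finite, h, lt_aleph0_iff_set_finite]

theorem SameInvariants.symm (h : SameInvariants α β) : SameInvariants β α := by
  obtain ⟨⟨h₁, h₂, h₃⟩, h₄, h₅⟩ := h
  refine ⟨⟨fun k hk => (h₁ k hk).symm, h₂.symm, h₃.symm⟩,
    fun hf => (h₄ ((finite_congr h₂).2 hf)).symm, fun hf => ?_⟩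
  obtain ⟨h₆, h₇⟩ := h₅ ((finite_congr h₃).2 hf)
  refine ⟨h₆.symm, fun K hK hβ => ?_⟩
  obtain ⟨h₈, h₉⟩ := h₇ K hK (h₆.trans hβ)
  exact ⟨h₈.symm, fun k hk hkK => (h₉ k (h₈ ▸ hk) hkK).symm⟩

variable [Countable X]

theorem countable_advancing : (rightRays α ∪ doubleRays α).Countable := by
  rw [← image_advancingPoints]
  exact (Set.to_countable _).image _

theorem countable_terminating (hk : 1 ≤ k) : (leftRays α ∪ chainsFrom α k).Countable := by
  rw [← image_lastPoints hk]
  exact (Set.to_countable _).image _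

/-- Infinitely many double rays of `β` absorb all right and double rays of `α`; otherwise each type
is matched with itself. -/
theorem hasMatching_advancing (h : #(doubleRays α) = #(doubleRays β))
    (h' : (doubleRays α).Finite → #(rightRays α) = #(rightRays β)) :
    HasMatching (CompatComponents α β) (rightRays α ∪ doubleRays α)
      (rightRays β ∪ doubleRays β) := by
  by_cases hfin : (doubleRays α).Finite
  · exact (hasMatching_of_mk_eq (h' hfin) fun _ hη _ hθ => compatComponents_rightRays hη hθ).union
      (hasMatching_of_mk_eq h fun _ hη _ hθ => compatComponents_doubleRays (.inr hη) hθ)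
      disjoint_rightRays_doubleRays
  · have hinf : (doubleRays β).Infinite := fun hf =>
      hfin (lt_aleph0_iff_set_finite.1 (h ▸ lt_aleph0_iff_set_finite.2 hf))
    refine (hasMatching_of_infinite countable_advancing fun η hη => ?_).mono
      Set.subset_union_right
    exact hinf.mono fun θ hθ => ⟨hθ, compatComponents_doubleRays hη hθ⟩

/-- If lengths are unbounded, every chain has infinitely many targets at least as long. If they are
bounded, chains longer than `m_α` are matched length by length, and the rest go into the infinitely
many chains of `β` of length `m_α`. -/
theorem hasMatching_chainsFrom (h : maxChain α = maxChain β)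
    (h' : ∀ K : ℕ, 1 ≤ K → maxChain α = K → maxInfChain α = maxInfChain β ∧
      ∀ k : ℕ, maxInfChain α + 1 ≤ k → k ≤ K → #(chains α k) = #(chains β k)) :
    HasMatching (CompatComponents α β) (chainsFrom α 1) (chainsFrom β 1) := by
  have hcount : (chainsFrom α 1).Countable :=
    (countable_terminating le_rfl).mono Set.subset_union_right
  rcases eq_or_ne (maxChain α) ⊤ with htop | htop
  · refine hasMatching_of_infinite hcount fun η hη => ?_
    obtain ⟨j, hj, hη⟩ := mem_chainsFrom.1 hη
    refine (infinite_chainsFrom (h ▸ htop) hj).mono fun θ hθ => ?_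
    refine ⟨chainsFrom_anti hj hθ, ?_⟩
    obtain ⟨k, hk, hθ⟩ := mem_chainsFrom.1 hθ
    exact compatComponents_chains hj hk hη hθ
  obtain ⟨K, hK⟩ := ENat.ne_top_iff_exists.1 htop
  rcases K.eq_zero_or_pos with rfl | hKpos
  · have : chainsFrom α 1 = ∅ := by
      rw [← Set.not_nonempty_iff_eq_empty, ← natCast_le_maxChain le_rfl, ← hK]
      norm_num
    rw [this]
    exact hasMatching_empty
  obtain ⟨hm, hc⟩ := h' K hKpos hK.symm
  have hhigh : HasMatching (CompatComponents α β) (chainsFrom α (maxInfChain α + 1))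
      (chainsFrom β (maxInfChain α + 1)) := by
    refine HasMatching.iUnion (fun i => ?_) fun i j hij =>
      disjoint_chains (by omega) (by omega) (by omega)
    have hempty : ∀ {γ : SymInv X}, maxChain γ = K → ¬ maxInfChain α + 1 + i ≤ K →
        chains γ (maxInfChain α + 1 + i) = ∅ := fun {γ} hγ hlt =>
      Set.eq_empty_iff_forall_notMem.2 fun θ hθ => hlt <| by
        have := mem_chains_le_maxChain (by omega) hθ
        rw [hγ] at this
        exact_mod_cast this
    refine hasMatching_of_mk_eq ?_ fun _ hη _ hθ =>
      compatComponents_chains (by omega) le_rfl hη hθ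
    by_cases hle : maxInfChain α + 1 + i ≤ K
    · exact hc _ (by omega) hle
    · rw [hempty hK.symm hle, hempty (h ▸ hK.symm) hle]
  rcases Nat.eq_zero_or_pos (maxInfChain α) with h0 | hpos
  · rwa [h0] at hhigh
  -- As `m_β = m_α`, infinitely many chains of `β` have length at least `m_α` but only finitely many
  -- are longer.
  have hinf : (chains β (maxInfChain α)).Infinite := by
    intro hfin
    have hlt : ¬ (chainsFrom β (maxInfChain β)).Finite := by
      rw [← maxInfChain_lt_iff (h ▸ hK.symm) (hm ▸ hpos)]
      exact lt_irrefl _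
    rw [← hm, chainsFrom_eq_union] at hlt
    refine hlt (hfin.union ((maxInfChain_lt_iff (h ▸ hK.symm) (by omega)).1 ?_))
    omega
  have hlow : HasMatching (CompatComponents α β)
      (chainsFrom α 1 \ chainsFrom α (maxInfChain α + 1)) (chains β (maxInfChain α)) := by
    refine hasMatching_of_infinite (hcount.mono Set.sdiff_subset) fun η hη => ?_
    obtain ⟨j, hj, hηj⟩ := mem_chainsFrom.1 hη.1
    have hjm : j ≤ maxInfChain α := by
      by_contra hlt
      exact hη.2 (mem_chainsFrom.2 ⟨j, by omega, hηj⟩)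
    exact hinf.mono fun θ hθ => ⟨hθ, compatComponents_chains hj hjm hηj hθ⟩
  have := hlow.union hhigh (disjoint_chains_chainsFrom hpos (Nat.lt_succ_self _))
  rw [Set.sdiff_union_of_subset (chainsFrom_anti (by omega)), ← chainsFrom_eq_union] at this
  exact this.mono (chainsFrom_anti hpos)

theorem hasMatching_terminating (h : #(leftRays α) = #(leftRays β))
    (h' : (leftRays α).Finite →
      HasMatching (CompatComponents α β) (chainsFrom α 1) (chainsFrom β 1)) :
    HasMatching (CompatComponents α β) (leftRays α ∪ chainsFrom α 1)
      (leftRays β ∪ chainsFrom β 1) := by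
  by_cases hfin : (leftRays α).Finite
  · exact (hasMatching_of_mk_eq h fun _ hη _ hθ => compatComponents_leftRays (.inl hη) hθ).union
      (h' hfin) (disjoint_leftRays_chainsFrom le_rfl)
  · have hinf : (leftRays β).Infinite := fun hf =>
      hfin (lt_aleph0_iff_set_finite.1 (h ▸ lt_aleph0_iff_set_finite.2 hf))
    refine (hasMatching_of_infinite (countable_terminating le_rfl) fun η hη => ?_).mono
      Set.subset_union_left
    exact hinf.mono fun θ hθ => ⟨hθ, compatComponents_leftRays hη hθ⟩

theorem SameInvariants.exists_intertwines (h : SameInvariants α β) :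
    ∃ γ, Intertwines α β γ := by
  obtain ⟨⟨h₁, h₂, h₃⟩, h₄, h₅⟩ := h
  have hcyc : HasMatching (CompatComponents α β) (⋃ k, cycles α k) (⋃ k, cycles β k) := by
    refine HasMatching.iUnion (fun k => hasMatching_of_mk_eq ?_ fun _ hη _ hθ =>
      compatComponents_cycles hη hθ) fun i j hij => disjoint_cycles hij
    -- The union runs over all natural numbers; length `0` contributes no cycles.
    rcases k.eq_zero_or_pos with rfl | hk
    · have : ∀ γ : SymInv X, cycles γ 0 = ∅ := fun γ =>
        Set.eq_empty_iff_forall_notMem.2 fun _ hθ => absurd hθ.2.1 (by omega)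
      rw [this, this]
    · exact h₁ k hk
  obtain ⟨f, hf, hfP⟩ := hcyc.union ((hasMatching_advancing h₂ h₄).union
    (hasMatching_terminating h₃ fun hfin =>
      hasMatching_chainsFrom (h₅ hfin).1 (h₅ hfin).2) disjoint_advancing_terminating)
    (Set.disjoint_union_right.2 ⟨disjoint_cycles_advancing, disjoint_cycles_terminating⟩)
  exact SymInv.exists_intertwines f (hf.mono components_subset) fun η hη =>
    (hfP η (components_subset hη)).2

/-- Antisymmetry turns the two families of inequalities into equalities, and finite numbers of
double rays or left rays are then cancelled. -/
theorem sameInvariants_of_intertwines {γ δ : SymInv X} (h : Intertwines α β γ)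
    (h' : Intertwines β α δ) : SameInvariants α β := by
  have hΩ := le_antisymm h.mk_doubleRays_le h'.mk_doubleRays_le
  have hΛ := le_antisymm h.mk_leftRays_le h'.mk_leftRays_le
  refine ⟨⟨fun k _ => le_antisymm (h.mk_cycles_le k) (h'.mk_cycles_le k), hΩ, hΛ⟩,
    fun hfin => ?_, fun hfin => ?_⟩
  · have := le_antisymm h.mk_rightRays_add_doubleRays_le h'.mk_rightRays_add_doubleRays_le
    rw [← hΩ] at this
    exact Cardinal.eq_of_add_eq_add_right this (lt_aleph0_iff_set_finite.2 hfin)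
  · have hE : ∀ k, 1 ≤ k → #(chainsFrom α k) = #(chainsFrom β k) := fun k hk => by
      have := le_antisymm (h.mk_leftRays_add_chainsFrom_le hk)
        (h'.mk_leftRays_add_chainsFrom_le hk)
      rw [← hΛ] at this
      exact Cardinal.eq_of_add_eq_add_left this (lt_aleph0_iff_set_finite.2 hfin)
    exact ⟨maxChain_congr hE, fun K _ hK => ⟨maxInfChain_congr hK hE,
      fun k hk _ => mk_chains_congr hK hE hk⟩⟩

end Assembly

end SymInv

theorem mainTheorem1 {X : Type*} [Countable X] (α β : SymInv X) :
    CConj α β ↔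
      ((∀ k : ℕ, 1 ≤ k → #(α.cycles k) = #(β.cycles k)) ∧
          #α.doubleRays = #β.doubleRays ∧ #α.leftRays = #β.leftRays) ∧
        (α.doubleRays.Finite → #α.rightRays = #β.rightRays) ∧
        (α.leftRays.Finite →
          α.maxChain = β.maxChain ∧
            ∀ K : ℕ, 1 ≤ K → α.maxChain = (K : ℕ∞) →
              α.maxInfChain = β.maxInfChain ∧
                ∀ k : ℕ, α.maxInfChain + 1 ≤ k → k ≤ K →
                  #(α.chains k) = #(β.chains k)) := by
  rw [SymInv.cConj_iff]
  constructor
  · rintro ⟨⟨γ, hγ⟩, δ, hδ⟩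
    exact SymInv.sameInvariants_of_intertwines hγ hδ
  · intro h
    have h : SymInv.SameInvariants α β := h
    exact ⟨h.exists_intertwines, h.symm.exists_intertwines⟩
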